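/- Throughout, $R$ is a commutative ring and $G$, $G'$ are finitely generated free abelian groups. *Fans.* A prime ideal of a commutative monoid $P$ (written additively) is a subset $\mathfrak p\subseteq P$ (possibly empty) with $\mathfrak p+P\subseteq\mathfrak p$ whose complement is a submonoid. A convex cone in $G$ is a finitely generated submonoid $P\subseteq G$ which is saturated (if $x\in P^{\mathrm{gp}}$ and $nx\in P$ for some $n\ge 1$ then $x\in P$), has $P\cap(-P)=\{0\}$, and is such that $G/P^{\mathrm{gp}}$ is torsion free, where $P^{\mathrm{gp}}\subseteq G$ is the subgroup generated by $P$. A fan $(G,\triangle)$ is a nonempty collection $\triangle$ (finite or infinite) of convex cones in $G$ such that (1) $P\setminus\mathfrak p\in\triangle$ for every $P\in\triangle$ and every prime ideal $\mathfrak p$ of $P$, and (2) for all $P,Q\in\triangle$ there are prime ideals $\mathfrak p$ of $P$ and $\mathfrak q$ of $Q$ with $P\cap Q=P\setminus\mathfrak p=Q\setminus\mathfrak q$. A homomorphism of fans $\varphi\colon(G,\triangle)\to(G',\triangle')$ is a group homomorphism $\varphi\colon G\to G'$ such that for every $P\in\triangle$ there is $P'\in\triangle'$ with $\varphi(P)\subseteq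 P'$. *Log schemes.* A log structure on a scheme $X$ is a (Zariski) sheaf of commutative monoids $\mathcal M$ on $X$ with a homomorphism $\alpha\colon\mathcal M\to\mathcal O_X$ to the multiplicative monoid of $\mathcal O_X$ such that $\alpha^{-1}(\mathcal O_X^*)\to\mathcal O_X^*$ is an isomorphism. A morphism of log schemes $(X,\mathcal M)\to(Y,\mathcal N)$ is a morphism of schemes $f\colon X\to Y$ together with a homomorphism $f^\flat\colon\mathcal N\to f_*\mathcal M$ of sheaves of monoids compatible with $f^\sharp\colon\mathcal O_Y\to f_*\mathcal O_X$. It is a morphism over $R$ if $f$ is a morphism of schemes over $\operatorname{Spec}R$. *Toric schemes.* For $P\in\triangle$ let $P^\vee=\{\sigma\in\operatorname{Hom}(G,\mathbb Z):\sigma(P)\subseteq\mathbb Z_{\ge 0}\}$, let $U_P=\operatorname{Spec}R[P^\vee]$, and let $\mathcal M_P$ be the log structure on $U_P$ generated by $P^\vee\to R[P^\vee]$, i.e. the sheaf associated with $V\mapsto$ the pushout of $P^\vee\leftarrow\beta_V^{-1}(\mathcal O(V)^*)\to\mathcal O(V)^*$, where $\beta_V\colon P^\vee\to\mathcal O(V)$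 is the canonical map. For $Q\subseteq P$ in $\triangle$, the inclusion $P^\vee\subseteq Q^\vee$ makes $U_Q$ an open subscheme of $U_P$. The toric scheme $\mathrm{Temb}_R(\triangle)$ is the $R$-scheme obtained by gluing the $U_P$, $P\in\triangle$, where $U_P$ and $U_Q$ are glued along $U_{P\cap Q}$; its canonical log structure $\mathcal M_\triangle$ is obtained by gluing the $\mathcal M_P$. **Theorem.** Let $\varphi\colon(G,\triangle)\to(G',\triangle')$ be a homomorphism of fans. Then there is a unique morphism of log schemes over $R$ $$\varphi_*\colon(\mathrm{Temb}_R(\triangle),\mathcal M_\triangle)\longrightarrow(\mathrm{Temb}_R(\triangle'),\mathcal M_{\triangle'})$$ such that for all $P\in\triangle$ and $P'\in\triangle'$ with $\varphi(P)\subseteq P'$, the restriction of $\varphi_*$ to $(U_P,\mathcal M_P)$ is the composite of the morphism of log schemes $(U_P,\mathcal M_P)\to(U_{P'},\mathcal M_{P'})$ induced by the homomorphism $P'^\vee\to P^\vee$, $\sigma\mapsto\sigma\circ\varphi$, with the inclusion $(U_{P'},\mathcal M_{P'})\to(\mathrm{Temb}_R(\triangle'),\mathcal M_{\triangle'})$.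 -/

import Mathlib

open CategoryTheory Limits TopologicalSpace AlgebraicGeometry Opposite

universe u

set_option linter.unusedVariables false

namespace ToricGeometry

noncomputable section

/-! ### Convex cones and fans -/

/-- A prime ideal of a commutative monoid `M` (written additively): an ideal `I`, i.e.
`I + M ⊆ I`, whose complement is a submonoid. The empty set is allowed. -/
structure IsPrimeMonoidIdeal {M : Type*} [AddCommMonoid M] (I : Set M) : Prop where
  add_mem : ∀ x ∈ I, ∀ y, x + y ∈ I
  zero_notMem : 0 ∉ I
  add_notMem : ∀ x, x ∉ I → ∀ y, y ∉ I → x + y ∉ I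

/-- `F` is a face of the submonoid `P` of `G`: `F = P - 𝔭` for some prime ideal `𝔭` of `P`. -/
def IsFace {G : Type*} [AddCommGroup G] (F P : AddSubmonoid G) : Prop :=
  ∃ 𝔭 : Set P, IsPrimeMonoidIdeal 𝔭 ∧ (F : Set G) = Subtype.val '' 𝔭ᶜ

/-- A convex cone in `G`: a finitely generated saturated submonoid `P` of `G` with trivial units
such that `G / Pᵍᵖ` is torsion free; here `Pᵍᵖ` is the subgroup of `G` generated by `P`. -/
structure IsConvexCone {G : Type*} [AddCommGroup G] (P : AddSubmonoid G) : Prop where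
  fg : P.FG
  saturated : ∀ x ∈ AddSubgroup.closure (P : Set G), ∀ n : ℕ, 0 < n → n • x ∈ P → x ∈ P
  sharp : ∀ x ∈ P, -x ∈ P → x = 0
  torsionFree : IsAddTorsionFree (G ⧸ AddSubgroup.closure (P : Set G))

/-- A fan in `G`: a nonempty collection of convex cones in `G`, closed under taking faces, such
that any two of its members meet in a common face. -/
structure Fan (G : Type*) [AddCommGroup G] where
  cones : Set (AddSubmonoid G)
  nonempty : cones.Nonempty
  isConvexCone : ∀ P ∈ cones, IsConvexCone P
  face_mem : ∀ P ∈ cones, ∀ F, IsFace F P → F ∈ cones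
  inter_isFace : ∀ P ∈ cones, ∀ Q ∈ cones, IsFace (P ⊓ Q) P ∧ IsFace (P ⊓ Q) Q

/-- A homomorphism of fans `(G, Δ) → (G', Δ')`: a homomorphism of groups that maps each member of
`Δ` into some member of `Δ'`. -/
structure FanHom {G G' : Type*} [AddCommGroup G] [AddCommGroup G'] (Δ : Fan G) (Δ' : Fan G') where
  toHom : G →+ G'
  exists_le : ∀ P ∈ Δ.cones, ∃ P' ∈ Δ'.cones, P.map toHom ≤ P'

/-- The dual `P^∨ ⊆ G⋆ = Hom(G, ℤ)` of a submonoid `P` of `G`: the homomorphisms that are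
nonnegative on `P`. -/
def dual {G : Type*} [AddCommGroup G] (P : AddSubmonoid G) : AddSubmonoid (G →+ ℤ) where
  carrier := {σ | ∀ x ∈ P, 0 ≤ σ x}
  zero_mem' _ _ := le_rfl
  add_mem' hσ hτ x hx := add_nonneg (hσ x hx) (hτ x hx)

/-- `P^∨` as an object of the category of commutative monoids, written multiplicatively. -/
def dualMon {G : Type u} [AddCommGroup G] (P : AddSubmonoid G) : CommMonCat.{u} :=
  CommMonCat.of (Multiplicative (dual P))

/-- A homomorphism `φ : G → G'` with `φ(P) ⊆ P'` induces `P'^∨ → P^∨`, `σ ↦ σ ∘ φ`. -/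
def dualMonMap {G G' : Type u} [AddCommGroup G] [AddCommGroup G'] (φ : G →+ G')
    {P : AddSubmonoid G} {P' : AddSubmonoid G'} (h : P.map φ ≤ P') : dualMon P' ⟶ dualMon P :=
  CommMonCat.ofHom (AddMonoidHom.toMultiplicative
    { toFun σ := ⟨σ.1.comp φ, fun x hx => σ.2 (φ x) (h (AddSubmonoid.mem_map_of_mem φ hx))⟩
      map_zero' := rfl
      map_add' _ _ := rfl })

/-! ### Faces are cut out by linear forms -/

theorem IsFace.le {G : Type*} [AddCommGroup G] {F P : AddSubmonoid G} (h : IsFace F P) :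
    F ≤ P := by
  obtain ⟨𝔭, -, h⟩ := h
  intro x hx
  rw [← SetLike.mem_coe, h] at hx
  obtain ⟨y, -, rfl⟩ := hx
  exact y.2

theorem IsFace.mem_left {G : Type*} [AddCommGroup G] {F P : AddSubmonoid G} (h : IsFace F P)
    {x y : G} (hx : x ∈ P) (hy : y ∈ P) (hxy : x + y ∈ F) : x ∈ F := by
  obtain ⟨𝔭, hp, h⟩ := h
  rw [← SetLike.mem_coe, h] at hxy ⊢
  obtain ⟨z, hz, hz'⟩ := hxy
  refine ⟨⟨x, hx⟩, fun hx' => hz ?_, rfl⟩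
  have := hp.add_mem _ hx' ⟨y, hy⟩
  convert this
  exact Subtype.ext hz'

/-- Farkas' lemma over `ℤ`. -/
theorem farkas {W : Type*} [AddCommGroup W] (n : ℕ) : ∀ (a : Fin n → W →+ ℤ) (b : W →+ ℤ),
    (∀ x, (∀ i, a i x ≤ 0) → b x ≤ 0) →
    ∃ k : ℕ, 0 < k ∧ ∃ c : Fin n → ℤ, (∀ i, 0 ≤ c i) ∧ ∀ x, k * b x = ∑ i, c i * a i x := by
  induction n with
  | zero =>
    intro a b h
    refine ⟨1, one_pos, fun _ => 0, fun _ => le_rfl, fun x => ?_⟩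
    have h1 := h x (fun i => i.elim0)
    have h2 := h (-x) (fun i => i.elim0)
    rw [map_neg] at h2
    simp; omega
  | succ n ih =>
    intro a b h
    by_cases hb : ∀ x, (∀ i : Fin n, a i.castSucc x ≤ 0) → b x ≤ 0
    · obtain ⟨k, hk, c, hc, h⟩ := ih (fun i => a i.castSucc) b hb
      refine ⟨k, hk, Fin.snoc c 0, fun i => ?_, fun x => ?_⟩
      · refine Fin.lastCases ?_ (fun i => ?_) i <;> simp [hc]
      · rw [h, Fin.sum_univ_castSucc]; simp
    · push Not at hb
      obtain ⟨x₀, h₀, hb₀⟩ := hb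
      have ht : 0 < a (Fin.last n) x₀ := by
        by_contra hh
        push Not at hh
        exact absurd (h x₀ (fun i => Fin.lastCases hh h₀ i)) (not_le.mpr hb₀)
      set t := a (Fin.last n) x₀ with ht_def
      obtain ⟨k, hk, c, hc, hh⟩ := ih
        (fun i => t • a i.castSucc - (a i.castSucc x₀) • a (Fin.last n))
        (t • b - (b x₀) • a (Fin.last n)) (by
          intro x hx
          have := h (t • x - (a (Fin.last n) x) • x₀) (fun i => by
            refine Fin.lastCases ?_ (fun i => ?_) i
            · simp [← ht_def, mul_comm]
            · have := hx i
              simp at this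
              simp
              linarith)
          simp at this
          simp
          linarith)
      refine ⟨k * t.toNat, Nat.mul_pos hk (by omega),
        Fin.snoc (fun i => c i * t) (k * b x₀ - ∑ i, c i * a i.castSucc x₀), fun i => ?_,
        fun x => ?_⟩
      · refine Fin.lastCases ?_ (fun i => ?_) i
        · simp only [Fin.snoc_last]
          have h1 : ∑ i, c i * a i.castSucc x₀ ≤ 0 :=
            Finset.sum_nonpos fun i _ => mul_nonpos_of_nonneg_of_nonpos (hc i) (h₀ i)
          have h2 : 0 ≤ (k : ℤ) * b x₀ := mul_nonneg (by positivity) hb₀.le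
          linarith
        · simp only [Fin.snoc_castSucc]
          exact mul_nonneg (hc i) ht.le
      · have := hh x
        simp only [AddMonoidHom.sub_apply, AddMonoidHom.smul_apply, smul_eq_mul, mul_sub,
          Finset.sum_sub_distrib] at this
        rw [Fin.sum_univ_castSucc]
        simp only [Fin.snoc_castSucc, Fin.snoc_last, sub_mul, Finset.sum_mul]
        push_cast [Int.toNat_of_nonneg ht.le]
        simp only [mul_assoc] at this ⊢
        linarith

/-- `τ` is a linear form that is nonnegative on `P` and vanishes on `P` exactly along `F`. -/
structure IsSupporting {G : Type*} [AddCommGroup G] (τ : G →+ ℤ) (F P : AddSubmonoid G) :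
    Prop where
  mem_dual : τ ∈ dual P
  eq_zero_iff : ∀ x ∈ P, τ x = 0 ↔ x ∈ F

theorem IsFace.exists_isSupporting {G : Type*} [AddCommGroup G] [Module.Free ℤ G]
    [Module.Finite ℤ G] {F P : AddSubmonoid G} (h : IsFace F P) (hP : P.FG) :
    ∃ τ, IsSupporting τ F P := by
  classical
  obtain ⟨S, rfl⟩ := hP
  set P := AddSubmonoid.closure (S : Set G)
  have hS : ∀ s ∈ S, s ∈ P := fun s hs => AddSubmonoid.subset_closure hs
  -- the linear forms that are nonnegative on `P` and vanish on `F`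
  have key : ∀ x ∈ S, ∃ τ : G →+ ℤ, (∀ s ∈ S, 0 ≤ τ s) ∧ (∀ s ∈ S, s ∈ F → τ s = 0) ∧
      (x ∉ F → 0 < τ x) := by
    intro x hx
    by_cases hxF : x ∈ F
    · exact ⟨0, by simp, by simp, fun h => absurd hxF h⟩
    by_contra! hcon
    let e := S.equivFin.symm
    let ev (s : G) : (G →+ ℤ) →+ ℤ := AddMonoidHom.eval s
    let a : Fin S.card → (G →+ ℤ) →+ ℤ := fun i => - ev (e i)
    let b : Fin S.card → (G →+ ℤ) →+ ℤ := fun i => if (e i : G) ∈ F then ev (e i) else 0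
    obtain ⟨k, hk, c, hc, hh⟩ := farkas (S.card + S.card) (Fin.append a b) (ev x) (by
      intro τ hτ
      have hA : ∀ s ∈ S, 0 ≤ τ s := fun s hs => by
        have := hτ (Fin.castAdd _ (e.symm ⟨s, hs⟩))
        simpa [a, ev] using this
      refine (hcon τ hA fun s hs hsF => le_antisymm ?_ (hA s hs)).2
      have := hτ (Fin.natAdd _ (e.symm ⟨s, hs⟩))
      rw [Fin.append_right] at this
      simpa [b, ev, hsF] using this)
    rw [Fin.forall_fin_add] at hc
    let p : G := ∑ i, c (Fin.castAdd _ i) • (e i : G)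
    let f : G := ∑ i, c (Fin.natAdd _ i) • (if (e i : G) ∈ F then (e i : G) else 0)
    have hp : p ∈ P := sum_mem fun i _ => by
      lift c (Fin.castAdd _ i) to ℕ using hc.1 i with m
      rw [natCast_zsmul]
      exact nsmul_mem (hS _ (e i).2) _
    have hf : f ∈ F := sum_mem fun i _ => by
      lift c (Fin.natAdd _ i) to ℕ using hc.2 i with m
      rw [natCast_zsmul]
      refine nsmul_mem ?_ _
      split_ifs with hi
      exacts [hi, zero_mem _]
    have hkx : k • x + p = f := by
      have hinj : ∀ y : G, (∀ τ : G →+ ℤ, τ y = 0) → y = 0 := fun y hy =>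
        (Module.forall_dual_apply_eq_zero_iff ℤ y).mp fun τ => hy τ.toAddMonoidHom
      rw [← sub_eq_zero]
      refine hinj _ fun τ => ?_
      have := hh τ
      rw [Fin.sum_univ_add] at this
      simp only [Fin.append_left, Fin.append_right, a, b, ev] at this
      have hb : ∀ i, (if (e i : G) ∈ F then AddMonoidHom.eval (e i : G) else 0 : (G →+ ℤ) →+ ℤ) τ
          = τ (if (e i : G) ∈ F then (e i : G) else 0) := by
        intro i; split_ifs <;> simp
      simp only [hb] at this
      simp only [p, f, map_sub, map_add, map_sum, map_nsmul, map_zsmul, nsmul_eq_mul, smul_eq_mul,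
        AddMonoidHom.neg_apply, AddMonoidHom.eval_apply_apply, mul_neg,
        Finset.sum_neg_distrib] at this ⊢
      linarith
    have hkF : k • x ∈ F := h.mem_left (nsmul_mem (hS x hx) k) hp (hkx ▸ hf)
    obtain ⟨m, rfl⟩ : ∃ m, k = m + 1 := ⟨k - 1, by omega⟩
    rw [add_comm, add_nsmul, one_nsmul] at hkF
    exact hxF (h.mem_left (hS x hx) (nsmul_mem (hS x hx) m) hkF)
  choose! τ h1 h2 h3 using key
  have hnn : ∀ s ∈ S, 0 ≤ (∑ x ∈ S, τ x) s := fun s hs => by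
    rw [AddMonoidHom.finsetSum_apply]
    exact Finset.sum_nonneg fun x hx => h1 x hx s hs
  have hd : (∑ x ∈ S, τ x) ∈ dual P := fun y hy => by
    induction hy using AddSubmonoid.closure_induction with
    | mem x hx => exact hnn x hx
    | zero => simp
    | add x y _ _ hx hy => rw [map_add]; exact add_nonneg hx hy
  refine ⟨∑ x ∈ S, τ x, hd, fun y hy => ?_⟩
  induction hy using AddSubmonoid.closure_induction with
  | mem x hx =>
    refine ⟨fun h0 => by_contra fun hxF => ?_, fun hxF => ?_⟩
    · rw [AddMonoidHom.finsetSum_apply] at h0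
      have := (Finset.sum_eq_zero_iff_of_nonneg (fun z hz => h1 z hz x hx)).mp h0 x hx
      exact (h3 x hx hxF).ne' this
    · rw [AddMonoidHom.finsetSum_apply]
      exact Finset.sum_eq_zero fun z hz => h2 z hz x hx hxF
  | zero => simp [zero_mem]
  | add x y hxP hyP hx hy =>
    have hx0 := hd x hxP
    have hy0 := hd y hyP
    rw [map_add]
    constructor
    · intro h0
      exact add_mem (hx.mp (by linarith)) (hy.mp (by linarith))
    · intro hF
      rw [hx.mpr (h.mem_left hxP hyP hF), hy.mpr (h.mem_left hyP hxP (add_comm x y ▸ hF)),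
        add_zero]

theorem IsSupporting.add {G : Type*} [AddCommGroup G] {τ σ : G →+ ℤ} {E F P : AddSubmonoid G}
    (hτ : IsSupporting τ E P) (hσ : IsSupporting σ F P) : IsSupporting (τ + σ) (E ⊓ F) P where
  mem_dual := add_mem hτ.mem_dual hσ.mem_dual
  eq_zero_iff x hx := by
    have h1 := hτ.mem_dual x hx
    have h2 := hσ.mem_dual x hx
    rw [AddSubmonoid.mem_inf, ← hτ.eq_zero_iff x hx, ← hσ.eq_zero_iff x hx, AddMonoidHom.add_apply]
    constructor
    · intro h; constructor <;> linarith
    · rintro ⟨h, h'⟩; linarith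

theorem IsSupporting.exists_add_mem {G : Type*} [AddCommGroup G] {τ : G →+ ℤ}
    {F P : AddSubmonoid G} (hτ : IsSupporting τ F P) (hP : P.FG) {σ : G →+ ℤ} (hσ : σ ∈ dual F) :
    ∃ n : ℕ, σ + n • τ ∈ dual P := by
  obtain ⟨S, rfl⟩ := hP
  refine ⟨∑ s ∈ S, (σ s).natAbs, fun y hy => ?_⟩
  induction hy using AddSubmonoid.closure_induction with
  | mem x hx =>
    have hxP := AddSubmonoid.subset_closure hx
    have h1 : 0 ≤ τ x := hτ.mem_dual x hxP
    simp only [AddMonoidHom.add_apply, AddMonoidHom.smul_apply, nsmul_eq_mul]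
    by_cases h0 : τ x = 0
    · simpa [h0] using hσ x ((hτ.eq_zero_iff x hxP).mp h0)
    · have h2 : (σ x).natAbs ≤ ∑ s ∈ S, (σ s).natAbs :=
        Finset.single_le_sum (f := fun s => (σ s).natAbs) (fun _ _ => Nat.zero_le _) hx
      have h3 : ((σ x).natAbs : ℤ) ≤ ((∑ s ∈ S, (σ s).natAbs : ℕ) : ℤ) := by exact_mod_cast h2
      have h4 : ((∑ s ∈ S, (σ s).natAbs : ℕ) : ℤ) * 1 ≤
        ((∑ s ∈ S, (σ s).natAbs : ℕ) : ℤ) * τ x :=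
        mul_le_mul_of_nonneg_left (by omega) (by positivity)
      omega
  | zero => simp
  | add x y _ _ hx hy => rw [map_add]; exact add_nonneg hx hy

/-- If `F` is the face of `P` cut out by `τ`, then `R[F^∨]` is the localization of `R[P^∨]` at the
monomial `τ`. -/
theorem IsSupporting.isLocalization (R : Type*) [CommRing R] {G : Type*} [AddCommGroup G]
    {τ : G →+ ℤ} {F P : AddSubmonoid G} (hτ : IsSupporting τ F P) (hP : P.FG) (hFP : F ≤ P)
    (j : Multiplicative (dual P) →* Multiplicative (dual F))
    (hj : ∀ σ, ((j σ).toAdd : G →+ ℤ) = σ.toAdd) :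
    let := (MonoidAlgebra.mapDomainRingHom R j).toAlgebra
    IsLocalization.Away (MonoidAlgebra.of R (Multiplicative (dual P))
      (Multiplicative.ofAdd ⟨τ, hτ.mem_dual⟩))
      (MonoidAlgebra R (Multiplicative (dual F))) := by
  let := (MonoidAlgebra.mapDomainRingHom R j).toAlgebra
  set t : Multiplicative (dual P) := Multiplicative.ofAdd ⟨τ, hτ.mem_dual⟩
  have hjinj : Function.Injective j := fun a b hab => by
    have := congrArg (fun z => (z.toAdd : G →+ ℤ)) hab
    simp only [hj] at this
    exact Multiplicative.toAdd.injective (Subtype.ext this)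
  have hneg : -τ ∈ dual F := fun x hx => by
    simp [(hτ.eq_zero_iff x (hFP hx)).mpr hx]
  have halg : ∀ z, algebraMap (MonoidAlgebra R (Multiplicative (dual P)))
      (MonoidAlgebra R (Multiplicative (dual F))) z = MonoidAlgebra.mapDomainRingHom R j z :=
    fun _ => rfl
  have hof : ∀ m, algebraMap (MonoidAlgebra R (Multiplicative (dual P)))
      (MonoidAlgebra R (Multiplicative (dual F))) (MonoidAlgebra.of R _ m) =
      MonoidAlgebra.of R _ (j m) := fun m => by
    rw [halg]; simp
  have hjt : j t * Multiplicative.ofAdd ⟨-τ, hneg⟩ = 1 := by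
    apply Multiplicative.toAdd.injective
    apply Subtype.ext
    simp [hj, t]
  refine IsLocalization.Away.mk _ ?_ ?_ ?_
  · rw [hof]
    exact ((Units.mkOfMulEqOne _ _ hjt).isUnit).map (MonoidAlgebra.of R _)
  · intro z
    induction z using MonoidAlgebra.induction_on with
    | of m =>
      obtain ⟨n, hn⟩ := hτ.exists_add_mem hP m.toAdd.2
      refine ⟨n, MonoidAlgebra.of R _ (Multiplicative.ofAdd ⟨_, hn⟩), ?_⟩
      rw [hof, hof, ← map_pow, ← map_mul]
      congr 1
      apply Multiplicative.toAdd.injective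
      apply Subtype.ext
      simp [hj, t]
    | add x y hx hy =>
      obtain ⟨n, a, ha⟩ := hx
      obtain ⟨m, b, hb⟩ := hy
      refine ⟨n + m, MonoidAlgebra.of R _ t ^ m * a + MonoidAlgebra.of R _ t ^ n * b, ?_⟩
      simp only [map_add, map_mul, map_pow, ← ha, ← hb]
      ring
    | smul r x hx =>
      obtain ⟨n, a, ha⟩ := hx
      refine ⟨n, r • a, ?_⟩
      rw [smul_mul_assoc, ha]
      exact (map_smul (MonoidAlgebra.mapDomainAlgHom R R j) r a).symm
  · intro a b hab
    refine ⟨0, ?_⟩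
    rw [pow_zero, one_mul, one_mul]
    exact MonoidAlgebra.mapDomain_injective hjinj hab

/-! ### Log schemes -/

/-- The structure sheaf of a scheme, as a presheaf of multiplicative monoids. -/
abbrev mulPresheaf (X : Scheme.{u}) : TopCat.Presheaf CommMonCat.{u} X :=
  X.presheaf ⋙ forget₂ CommRingCat CommMonCat

/-- Restriction of sections of a presheaf of commutative monoids. -/
def res {X : TopCat.{u}} (M : TopCat.Presheaf CommMonCat.{u} X) {V W : Opens X} (h : W ≤ V) :
    M.obj (op V) →* M.obj (op W) :=
  (M.map (homOfLE h).op).hom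

/-- The components of a homomorphism of presheaves of commutative monoids. -/
def comp {X : TopCat.{u}} {M N : TopCat.Presheaf CommMonCat.{u} X} (f : M ⟶ N) (V : Opens X) :
    M.obj (op V) →* N.obj (op V) :=
  (f.app (op V)).hom

theorem res_self {X : TopCat.{u}} (M : TopCat.Presheaf CommMonCat.{u} X) {V : Opens X}
    (h : V ≤ V) (s : M.obj (op V)) : res M h s = s :=
  congrArg (fun f => f.hom s) (M.map_id (op V))

theorem res_res {X : TopCat.{u}} (M : TopCat.Presheaf CommMonCat.{u} X) {U V W : Opens X}
    (h : V ≤ U) (h' : W ≤ V) (s : M.obj (op U)) : res M h' (res M h s) = res M (h'.trans h) s :=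
  (congrArg (fun f => f.hom s) (M.map_comp (homOfLE h).op (homOfLE h').op)).symm

theorem comp_res {X : TopCat.{u}} {M N : TopCat.Presheaf CommMonCat.{u} X} (f : M ⟶ N)
    {V W : Opens X} (h : W ≤ V) (s : M.obj (op V)) : comp f W (res M h s) = res N h (comp f V s) :=
  congrArg (fun f => f.hom s) (f.naturality (homOfLE h).op)

theorem appLE_res {X Y : Scheme.{u}} (f : X ⟶ Y) {V V' : Y.Opens} {U U' : X.Opens}
    (h : U ≤ f ⁻¹ᵁ V) (h' : U' ≤ f ⁻¹ᵁ V') (hV : V' ≤ V) (hU : U' ≤ U) (a : Γ(Y, V)) :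
    f.appLE V' U' h' (res (mulPresheaf Y) hV a) = res (mulPresheaf X) hU (f.appLE V U h a) :=
  (congrArg (fun k => k.hom a) (f.map_appLE h' (homOfLE hV).op)).trans
    (congrArg (fun k => k.hom a) (f.appLE_map h (homOfLE hU).op)).symm

theorem id_appLE_apply (X : Scheme.{u}) {V U : X.Opens} (h : U ≤ V) (a : Γ(X, V)) :
    (𝟙 X : X ⟶ X).appLE V U h a = res (mulPresheaf X) h a := by
  simp [Scheme.Hom.appLE, res]
  rfl

/-- A log scheme: a scheme `X` with a log structure (for the Zariski topology), i.e. a sheaf of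
commutative monoids `M` on `X` and a homomorphism `α : M → 𝒪_X` (to the multiplicative monoid of
`𝒪_X`) that restricts to an isomorphism `α⁻¹(𝒪_X^*) ≅ 𝒪_X^*`. -/
structure LogScheme where
  toScheme : Scheme.{u}
  M : TopCat.Presheaf CommMonCat.{u} toScheme
  isSheaf : M.IsSheaf
  α : M ⟶ mulPresheaf toScheme
  existsUnique_of_isUnit : ∀ (V : toScheme.Opens) (a : Γ(toScheme, V)), IsUnit a →
    ∃! s : M.obj (op V), comp α V s = a

namespace LogScheme

/-- A morphism of log schemes `(X, M) → (Y, N)`: a morphism of schemes `f : X → Y` and a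
homomorphism `f♭ : N → f_* M` of sheaves of monoids that is compatible with
`f♯ : 𝒪_Y → f_* 𝒪_X`. The homomorphism `f♭` is given by its components followed by restrictions,
`N(V) → M(f⁻¹ V) → M(U)` for `U ⊆ f⁻¹ V`, and `f.appLE V U` is the analogous map
`𝒪_Y(V) → 𝒪_X(f⁻¹ V) → 𝒪_X(U)` for `f♯`. -/
structure Hom (X Y : LogScheme.{u}) where
  hom : X.toScheme ⟶ Y.toScheme
  flat : ∀ (V : Y.toScheme.Opens) (U : X.toScheme.Opens), U ≤ hom ⁻¹ᵁ V →
    (Y.M.obj (op V) →* X.M.obj (op U))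
  flat_res : ∀ {V V' : Y.toScheme.Opens} {U U' : X.toScheme.Opens} (h : U ≤ hom ⁻¹ᵁ V)
    (h' : U' ≤ hom ⁻¹ᵁ V') (hV : V' ≤ V) (hU : U' ≤ U) (s : Y.M.obj (op V)),
    flat V' U' h' (res Y.M hV s) = res X.M hU (flat V U h s)
  comp_flat : ∀ (V : Y.toScheme.Opens) (U : X.toScheme.Opens) (h : U ≤ hom ⁻¹ᵁ V)
    (s : Y.M.obj (op V)), comp X.α U (flat V U h s) = hom.appLE V U h (comp Y.α V s)

theorem Hom.ext {X Y : LogScheme.{u}} {f g : Hom X Y} (h : f.hom = g.hom)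
    (h' : ∀ (V : Y.toScheme.Opens) (U : X.toScheme.Opens) (hf : U ≤ f.hom ⁻¹ᵁ V)
      (hg : U ≤ g.hom ⁻¹ᵁ V) (s : Y.M.obj (op V)), f.flat V U hf s = g.flat V U hg s) :
    f = g := by
  obtain ⟨f, f', _, hf⟩ := f
  obtain ⟨g, g', _, hg⟩ := g
  obtain rfl : f = g := h
  obtain rfl : f' = g' := by
    ext V U h s
    exact h' V U h h s
  rfl

/-- The identity morphism. -/
def Hom.id (X : LogScheme.{u}) : Hom X X where
  hom := 𝟙 _
  flat V U h := res X.M h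
  flat_res h h' hV hU s := (res_res _ _ _ _).trans (res_res _ _ _ _).symm
  comp_flat V U h s := (comp_res _ _ _).trans (id_appLE_apply _ h _).symm

/-- The composition of morphisms. -/
def Hom.trans {X Y Z : LogScheme.{u}} (f : Hom X Y) (g : Hom Y Z) : Hom X Z where
  hom := f.hom ≫ g.hom
  flat V U h := (f.flat (g.hom ⁻¹ᵁ V) U h).comp (g.flat V (g.hom ⁻¹ᵁ V) le_rfl)
  flat_res {V V' U U'} h h' hV hU s := by
    rw [MonoidHom.comp_apply, MonoidHom.comp_apply,
      g.flat_res le_rfl le_rfl hV (g.hom.preimage_mono hV)]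
    exact f.flat_res (V := g.hom ⁻¹ᵁ V) (V' := g.hom ⁻¹ᵁ V') h h' (g.hom.preimage_mono hV) hU _
  comp_flat V U h s := by
    refine (f.comp_flat (g.hom ⁻¹ᵁ V) U h _).trans ?_
    rw [g.comp_flat]
    exact congrArg (fun k => k.hom (comp Z.α V s))
      (Scheme.Hom.appLE_comp_appLE f.hom g.hom V (g.hom ⁻¹ᵁ V) U le_rfl h)

theorem Hom.flat_eq {X Y : LogScheme.{u}} (f : Hom X Y) {V : Y.toScheme.Opens}
    {U : X.toScheme.Opens} (V' : Y.toScheme.Opens) (h : U ≤ f.hom ⁻¹ᵁ V) (h' : U ≤ f.hom ⁻¹ᵁ V')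
    (hV : V' ≤ V) (s : Y.M.obj (op V)) : f.flat V' U h' (res Y.M hV s) = f.flat V U h s :=
  (f.flat_res h h' hV le_rfl s).trans (res_self _ _ _)

theorem Hom.trans_flat {X Y Z : LogScheme.{u}} (f : Hom X Y) (g : Hom Y Z)
    {V : Z.toScheme.Opens} {W : Y.toScheme.Opens} {U : X.toScheme.Opens}
    (h : U ≤ (f.trans g).hom ⁻¹ᵁ V) (hU : U ≤ f.hom ⁻¹ᵁ W) (hW : W ≤ g.hom ⁻¹ᵁ V)
    (s : Z.M.obj (op V)) : (f.trans g).flat V U h s = f.flat W U hU (g.flat V W hW s) := by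
  have := g.flat_res le_rfl hW le_rfl hW s
  rw [res_self] at this
  rw [this]
  exact (f.flat_eq W h hU hW _).symm

instance : Category LogScheme.{u} where
  Hom := Hom
  id := Hom.id
  comp := Hom.trans
  id_comp {X Y} f := Hom.ext (Category.id_comp f.hom) fun V U h h' s =>
    (Hom.trans_flat (Hom.id X) f (W := f.hom ⁻¹ᵁ V) h h' le_rfl s).trans
      ((f.flat_res (U := f.hom ⁻¹ᵁ V) le_rfl h' le_rfl h' s).symm.trans
        (f.flat_eq _ _ _ le_rfl s))
  comp_id {X Y} f := Hom.ext (Category.comp_id f.hom) fun V U h h' s =>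
    (Hom.trans_flat f (Hom.id Y) (W := V) h h' le_rfl s).trans (f.flat_eq _ _ _ _ s)
  assoc f g h := Hom.ext (Category.assoc f.hom g.hom h.hom) fun V U _ _ s => rfl

theorem id_hom (X : LogScheme.{u}) : Hom.hom (𝟙 X) = 𝟙 X.toScheme := rfl

theorem comp_hom {X Y Z : LogScheme.{u}} (f : X ⟶ Y) (g : Y ⟶ Z) :
    Hom.hom (f ≫ g) = Hom.hom f ≫ Hom.hom g := rfl

/-- The underlying scheme of a log scheme. -/
def forget : LogScheme.{u} ⥤ Scheme.{u} where
  obj X := X.toScheme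
  map f := Hom.hom f

end LogScheme

/-! ### The log structure associated with a chart -/

/-- The relation generating the pushout of `N ← g⁻¹(Aˣ) → Aˣ`. -/
def chartRel {N A : Type*} [CommMonoid N] [CommMonoid A] (g : N →* A) (p q : N × Aˣ) : Prop :=
  ∃ (n : N) (u : Aˣ), g n = u ∧ p = (n, 1) ∧ q = (1, u)

/-- For a homomorphism `g : N → A` of commutative monoids, the pushout of `N ← g⁻¹(Aˣ) → Aˣ` in
the category of commutative monoids. -/
abbrev ChartMonoid {N A : Type*} [CommMonoid N] [CommMonoid A] (g : N →* A) : Type _ :=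
  (conGen (chartRel g)).Quotient

namespace ChartMonoid

/-- The class of `(n, u)`. -/
def mk {N A : Type*} [CommMonoid N] [CommMonoid A] (g : N →* A) : N × Aˣ →* ChartMonoid g :=
  (conGen (chartRel g)).mk'

theorem mk_surjective {N A : Type*} [CommMonoid N] [CommMonoid A] (g : N →* A) :
    Function.Surjective (mk g) := Con.mk'_surjective

theorem mk_eq_mk_one {N A : Type*} [CommMonoid N] [CommMonoid A] (g : N →* A) (n : N)
    (u : Aˣ) (h : g n = u) : mk g (n, 1) = mk g (1, u) :=
  (Con.eq _).mpr (ConGen.Rel.of _ _ ⟨n, u, h, rfl, rfl⟩)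

/-- The homomorphism `ChartMonoid g → A`, `(n, u) ↦ g(n) u`. -/
def alpha {N A : Type*} [CommMonoid N] [CommMonoid A] (g : N →* A) : ChartMonoid g →* A :=
  Con.lift _ (g.coprod (Units.coeHom A)) <| Con.conGen_le.mpr <| by
    rintro _ _ ⟨n, u, h, rfl, rfl⟩
    simp [Con.ker_rel, h]

theorem alpha_mk {N A : Type*} [CommMonoid N] [CommMonoid A] (g : N →* A) (n : N) (u : Aˣ) :
    alpha g (mk g (n, u)) = g n * u := rfl

/-- Functoriality of `ChartMonoid`, `(n, u) ↦ (h(n), k(u))`. -/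
def map {N A N' A' : Type*} [CommMonoid N] [CommMonoid A] [CommMonoid N'] [CommMonoid A']
    {g : N →* A} {g' : N' →* A'} (h : N →* N') (k : A →* A') (w : ∀ n, k (g n) = g' (h n)) :
    ChartMonoid g →* ChartMonoid g' :=
  Con.lift _ ((mk g').comp (h.prodMap (Units.map k))) <| Con.conGen_le.mpr <| by
    rintro _ _ ⟨n, u, hn, rfl, rfl⟩
    have := mk_eq_mk_one g' (h n) (Units.map k u) (by rw [← w, hn]; rfl)
    simpa [Con.ker_rel] using this

theorem map_mk {N A N' A' : Type*} [CommMonoid N] [CommMonoid A] [CommMonoid N'] [CommMonoid A']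
    {g : N →* A} {g' : N' →* A'} (h : N →* N') (k : A →* A') (w : ∀ n, k (g n) = g' (h n))
    (n : N) (u : Aˣ) : map h k w (mk g (n, u)) = mk g' (h n, Units.map k u) := rfl

theorem hom_ext {N A B : Type*} [CommMonoid N] [CommMonoid A] [CommMonoid B] {g : N →* A}
    {f f' : ChartMonoid g →* B} (h : ∀ n u, f (mk g (n, u)) = f' (mk g (n, u))) : f = f' := by
  refine MonoidHom.ext fun x => ?_
  obtain ⟨⟨n, u⟩, rfl⟩ := mk_surjective g x
  exact h n u

theorem eq_mk_one_of_alpha {N A : Type*} [CommMonoid N] [CommMonoid A] (g : N →* A)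
    (x : ChartMonoid g) (a : Aˣ) (h : alpha g x = a) : x = mk g (1, a) := by
  obtain ⟨⟨n, u⟩, rfl⟩ := mk_surjective g x
  rw [alpha_mk] at h
  have h1 : mk g (n, u) = mk g (n, 1) * mk g (1, u) := by rw [← map_mul]; simp
  have h2 : mk g (1, a) = mk g (1, a * u⁻¹) * mk g (1, u) := by rw [← map_mul]; simp
  rw [h1, h2, mk_eq_mk_one g n (a * u⁻¹) (by rw [Units.val_mul, ← h, mul_assoc]; simp)]

end ChartMonoid

instance : HasFilteredColimitsOfSize.{u, u} CommMonCat.{u} where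
  HasColimitsOfShape _ _ _ :=
    ⟨fun F => ⟨⟨_, CommMonCat.FilteredColimits.colimitCoconeIsColimit.{u, u} F⟩⟩⟩

/-- Sheafification of a presheaf of commutative monoids. -/
def shf {X : TopCat.{u}} (P : TopCat.Presheaf CommMonCat.{u} X) : TopCat.Presheaf CommMonCat.{u} X :=
  CategoryTheory.sheafify (Opens.grothendieckTopology X) P

theorem shf_isSheaf {X : TopCat.{u}} (P : TopCat.Presheaf CommMonCat.{u} X) : (shf P).IsSheaf :=
  ((CategoryTheory.presheafToSheaf _ _).obj P).property

/-- The canonical homomorphism from a presheaf to its sheafification. -/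
def toShf {X : TopCat.{u}} (P : TopCat.Presheaf CommMonCat.{u} X) : P ⟶ shf P :=
  CategoryTheory.toSheafify _ _

/-- The homomorphism from the sheafification induced by a homomorphism to a sheaf. -/
def shfLift {X : TopCat.{u}} {P Q : TopCat.Presheaf CommMonCat.{u} X} (f : P ⟶ Q)
    (hQ : Q.IsSheaf) : shf P ⟶ Q :=
  CategoryTheory.sheafifyLift _ f hQ

theorem comp_shfLift {X : TopCat.{u}} {P Q : TopCat.Presheaf CommMonCat.{u} X} (f : P ⟶ Q)
    (hQ : Q.IsSheaf) (V : Opens X) (s : P.obj (op V)) :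
    comp (shfLift f hQ) V (comp (toShf P) V s) = comp f V s :=
  congrArg (fun k => (k.app (op V)).hom s)
    (CategoryTheory.toSheafify_sheafifyLift (Opens.grothendieckTopology X) f hQ)

theorem sheaf_ext {X : TopCat.{u}} {M : TopCat.Presheaf CommMonCat.{u} X} (hM : M.IsSheaf)
    {V : Opens X} (s t : M.obj (op V))
    (h : ∀ x ∈ V, ∃ (W : Opens X) (hW : W ≤ V), x ∈ W ∧ res M hW s = res M hW t) : s = t := by
  choose! W hW hx hst using h
  refine TopCat.Sheaf.eq_of_locally_eq' ⟨M, hM⟩ (fun x : V => W x.1) V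
    (fun x => homOfLE (hW x.1 x.2)) (fun x hxV => ?_) s t (fun x => hst x.1 x.2)
  exact Opens.mem_iSup.mpr ⟨⟨x, hxV⟩, hx x hxV⟩

theorem exists_toShf {X : TopCat.{u}} (P : TopCat.Presheaf CommMonCat.{u} X) {V : Opens X}
    (s : (shf P).obj (op V)) (x : X) (hx : x ∈ V) :
    ∃ (W : Opens X) (hW : W ≤ V), x ∈ W ∧ ∃ t : P.obj (op W), comp (toShf P) W t =
      res (shf P) hW s := by
  have : Presheaf.IsLocallySurjective (Opens.grothendieckTopology X) (toShf P) :=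
    inferInstanceAs (Presheaf.IsLocallySurjective (Opens.grothendieckTopology X)
      (CategoryTheory.toSheafify (Opens.grothendieckTopology X) P))
  obtain ⟨W, f, ⟨t, ht⟩, hxW⟩ :=
    Presheaf.imageSieve_mem (Opens.grothendieckTopology X) (toShf P) s x hx
  exact ⟨W, f.le, hxW, t, ht⟩

/-- Given a homomorphism `β` from a monoid `N` to the global sections of a presheaf `A` of
commutative monoids, the presheaf `V ↦` pushout of `N ← β_V⁻¹(A(V)^*) → A(V)^*`. -/
def chartPresheaf {X : TopCat.{u}} (A : TopCat.Presheaf CommMonCat.{u} X) {N : Type u}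
    [CommMonoid N] (β : N →* A.obj (op ⊤)) : TopCat.Presheaf CommMonCat.{u} X where
  obj V := CommMonCat.of (ChartMonoid ((res A (le_top : V.unop ≤ ⊤)).comp β))
  map i := CommMonCat.ofHom (ChartMonoid.map (MonoidHom.id N) (A.map i).hom
    fun n => res_res A le_top i.unop.le (β n))
  map_id V := CommMonCat.hom_ext <| ChartMonoid.hom_ext fun n u => by
    refine congrArg (fun z => ChartMonoid.mk _ (n, z)) (Units.ext ?_)
    exact congrArg (fun k => k.hom (u : A.obj V)) (A.map_id V)
  map_comp i j := CommMonCat.hom_ext <| ChartMonoid.hom_ext fun n u => by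
    refine congrArg (fun z => ChartMonoid.mk _ (n, z)) (Units.ext ?_)
    exact congrArg (fun k => k.hom (u : A.obj _)) (A.map_comp i j)

/-- The homomorphism `chartPresheaf A β → A`, `(n, u) ↦ β(n) u`. -/
def chartAlpha {X : TopCat.{u}} (A : TopCat.Presheaf CommMonCat.{u} X) {N : Type u}
    [CommMonoid N] (β : N →* A.obj (op ⊤)) : chartPresheaf A β ⟶ A where
  app V := CommMonCat.ofHom (ChartMonoid.alpha _)
  naturality V W i := CommMonCat.hom_ext <| ChartMonoid.hom_ext fun n u => by
    refine Eq.trans ?_ (map_mul (A.map i).hom _ _).symm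
    exact congrArg (· * (A.map i).hom u) (res_res A le_top i.unop.le (β n)).symm

/-- Functoriality of `chartPresheaf` in `(X, A, N, β)`. -/
def chartPresheafMap {X Y : TopCat.{u}} (f : X ⟶ Y) {A : TopCat.Presheaf CommMonCat.{u} X}
    {B : TopCat.Presheaf CommMonCat.{u} Y} (φ : B ⟶ (Opens.map f).op ⋙ A) {N N' : Type u}
    [CommMonoid N] [CommMonoid N'] (β : N →* A.obj (op ⊤)) (β' : N' →* B.obj (op ⊤))
    (h : N' →* N) (w : ∀ n, (φ.app (op ⊤)).hom (β' n) = β (h n)) :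
    chartPresheaf B β' ⟶ (Opens.map f).op ⋙ chartPresheaf A β where
  app V := CommMonCat.ofHom (ChartMonoid.map h (φ.app V).hom fun n =>
    (congrArg (fun k => k.hom (β' n)) (φ.naturality (homOfLE (le_top : V.unop ≤ ⊤)).op)).trans
      (congrArg (res A (le_top : (Opens.map f).obj V.unop ≤ ⊤)) (w n)))
  naturality V W i := CommMonCat.hom_ext <| ChartMonoid.hom_ext fun n u => by
    refine congrArg (fun z => ChartMonoid.mk _ (h n, z)) (Units.ext ?_)
    exact congrArg (fun k => k.hom (u : B.obj V)) (φ.naturality i)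

theorem mulPresheaf_isSheaf (X : Scheme.{u}) : (mulPresheaf X).IsSheaf :=
  CategoryTheory.Presheaf.isSheaf_comp_of_isSheaf _ _ _ X.sheaf.property

/-- The section of the sheafification of `chartPresheaf A β` represented by `(n, u)`. -/
def chartSec {X : TopCat.{u}} (A : TopCat.Presheaf CommMonCat.{u} X) {N : Type u}
    [CommMonoid N] (β : N →* A.obj (op ⊤)) (V : Opens X) (n : N) (a : (A.obj (op V))ˣ) :
    (shf (chartPresheaf A β)).obj (op V) :=
  comp (toShf (chartPresheaf A β)) V (ChartMonoid.mk ((res A (le_top : V ≤ ⊤)).comp β) (n, a))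

theorem res_chartSec {X : TopCat.{u}} (A : TopCat.Presheaf CommMonCat.{u} X) {N : Type u}
    [CommMonoid N] (β : N →* A.obj (op ⊤)) {V W : Opens X} (h : W ≤ V) (n : N)
    (a : (A.obj (op V))ˣ) :
    res _ h (chartSec A β V n a) = chartSec A β W n (Units.map (res A h) a) :=
  (comp_res (toShf (chartPresheaf A β)) h _).symm

theorem exists_chartSec {X : TopCat.{u}} (A : TopCat.Presheaf CommMonCat.{u} X) {N : Type u}
    [CommMonoid N] (β : N →* A.obj (op ⊤)) {V : Opens X}
    (s : (shf (chartPresheaf A β)).obj (op V)) (x : X) (hx : x ∈ V) :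
    ∃ (W : Opens X) (hW : W ≤ V), x ∈ W ∧ ∃ n a, res _ hW s = chartSec A β W n a := by
  obtain ⟨W, hW, hxW, t, ht⟩ := exists_toShf _ s x hx
  obtain ⟨⟨n, a⟩, rfl⟩ := ChartMonoid.mk_surjective _ t
  exact ⟨W, hW, hxW, n, a, ht.symm⟩

theorem comp_chartSec {X : TopCat.{u}} {A : TopCat.Presheaf CommMonCat.{u} X} (hA : A.IsSheaf)
    {N : Type u} [CommMonoid N] (β : N →* A.obj (op ⊤)) (V : Opens X) (n : N)
    (a : (A.obj (op V))ˣ) :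
    comp (shfLift (chartAlpha A β) hA) V (chartSec A β V n a) = res A (le_top : V ≤ ⊤) (β n) * a :=
  comp_shfLift _ _ V _

theorem chartSec_eq_one {X : TopCat.{u}} {A : TopCat.Presheaf CommMonCat.{u} X} {N : Type u}
    [CommMonoid N] (β : N →* A.obj (op ⊤)) (V : Opens X) (n : N) (a b : (A.obj (op V))ˣ)
    (h : res A (le_top : V ≤ ⊤) (β n) * a = (b : A.obj (op V))) :
    chartSec A β V n a = chartSec A β V 1 b :=
  congrArg (comp (toShf (chartPresheaf A β)) V) (ChartMonoid.eq_mk_one_of_alpha _ _ b h)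

namespace LogScheme

/-- The log structure on `X` associated with a chart `β : N → Γ(X, 𝒪_X)`, i.e. the sheafification
of `V ↦` pushout of `N ← β_V⁻¹(𝒪_X(V)^*) → 𝒪_X(V)^*`, with `α(n, u) = β(n) u`. -/
def ofChart (X : Scheme.{u}) {N : Type u} [CommMonoid N] (β : N →* (mulPresheaf X).obj (op ⊤)) :
    LogScheme.{u} where
  toScheme := X
  M := shf (chartPresheaf (mulPresheaf X) β)
  isSheaf := shf_isSheaf _
  α := shfLift (chartAlpha (mulPresheaf X) β) (mulPresheaf_isSheaf X)
  existsUnique_of_isUnit V a ha := by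
    obtain ⟨u, rfl⟩ := ha
    refine ⟨chartSec (mulPresheaf X) β V 1 u, ?_, fun s hs => ?_⟩
    · refine (comp_chartSec _ β V 1 u).trans ?_
      rw [map_one, map_one, one_mul]
    · refine sheaf_ext (shf_isSheaf _) _ _ fun x hx => ?_
      obtain ⟨W, hW, hxW, n, a, ha⟩ := exists_chartSec _ β s x hx
      refine ⟨W, hW, hxW, ?_⟩
      rw [ha, res_chartSec]
      refine chartSec_eq_one _ _ _ _ _ ?_
      rw [← comp_chartSec (mulPresheaf_isSheaf X), ← ha, comp_res]
      exact congrArg (res (mulPresheaf X) hW) hs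

/-- The homomorphism `f♭ : M_Y → f_* M_X` induced by a morphism of schemes `f : X → Y` and a
compatible homomorphism `h : N' → N` of charts. -/
def chartFlat {X Y : Scheme.{u}} (f : X ⟶ Y) {N N' : Type u} [CommMonoid N] [CommMonoid N']
    (β : N →* (mulPresheaf X).obj (op ⊤)) (β' : N' →* (mulPresheaf Y).obj (op ⊤)) (h : N' →* N)
    (w : ∀ n, f.app ⊤ (β' n) = β (h n)) :
    shf (chartPresheaf (mulPresheaf Y) β') ⟶
      (Opens.map f.base).op ⋙ shf (chartPresheaf (mulPresheaf X) β) :=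
  shfLift (chartPresheafMap f.base (Functor.whiskerRight f.c (forget₂ CommRingCat CommMonCat))
      β β' h w ≫ Functor.whiskerLeft (Opens.map f.base).op (toShf (chartPresheaf (mulPresheaf X) β)))
    (TopCat.Sheaf.pushforward_sheaf_of_sheaf f.base (shf_isSheaf _))

/-- The action of a morphism of schemes on units. -/
def unitsApp {X Y : Scheme.{u}} (f : X ⟶ Y) (V : Y.Opens) :
    ((mulPresheaf Y).obj (op V))ˣ →* ((mulPresheaf X).obj (op (f ⁻¹ᵁ V)))ˣ :=
  Units.map (f.app V).hom.toMonoidHom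

theorem chartFlat_chartSec {X Y : Scheme.{u}} (f : X ⟶ Y) {N N' : Type u} [CommMonoid N]
    [CommMonoid N'] (β : N →* (mulPresheaf X).obj (op ⊤)) (β' : N' →* (mulPresheaf Y).obj (op ⊤))
    (h : N' →* N) (w : ∀ n, f.app ⊤ (β' n) = β (h n)) (V : Y.Opens) (n : N')
    (a : ((mulPresheaf Y).obj (op V))ˣ) :
    comp (chartFlat f β β' h w) V (chartSec (mulPresheaf Y) β' V n a) =
      chartSec (mulPresheaf X) β (f ⁻¹ᵁ V) (h n) (unitsApp f V a) :=
  comp_shfLift _ _ V _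

/-- The morphism of log schemes induced by a morphism of schemes `f : X → Y` and a compatible
homomorphism `h : N' → N` of charts; on sections, `f♭(n, u) = (h(n), f♯(u))`. -/
def ofChartHom {X Y : Scheme.{u}} (f : X ⟶ Y) {N N' : Type u} [CommMonoid N] [CommMonoid N']
    (β : N →* (mulPresheaf X).obj (op ⊤)) (β' : N' →* (mulPresheaf Y).obj (op ⊤)) (h : N' →* N)
    (w : ∀ n, f.app ⊤ (β' n) = β (h n)) : Hom (ofChart X β) (ofChart Y β') where
  hom := f
  flat V U hU := (res (shf (chartPresheaf (mulPresheaf X) β)) hU).comp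
    (comp (chartFlat f β β' h w) V)
  flat_res {V V' U U'} hU hU' hV hUU s := by
    refine (congrArg (res (ofChart X β).M hU') (comp_res (chartFlat f β β' h w) hV s)).trans ?_
    exact (res_res (ofChart X β).M (f.preimage_mono hV) hU' (comp (chartFlat f β β' h w) V s)).trans
      (res_res (ofChart X β).M hU hUU (comp (chartFlat f β β' h w) V s)).symm
  comp_flat V U hU s := by
    refine sheaf_ext (mulPresheaf_isSheaf X) _ _ fun x hx => ?_
    obtain ⟨W, hW, hxW, n, a, hs⟩ := exists_chartSec _ β' s (f.base x) (hU hx)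
    refine ⟨U ⊓ f ⁻¹ᵁ W, inf_le_left, ⟨hx, hxW⟩, ?_⟩
    have h1 : res (mulPresheaf X) inf_le_left (f.appLE V U hU (comp (ofChart Y β').α V s)) =
        f.appLE W (U ⊓ f ⁻¹ᵁ W) inf_le_right
          (comp (ofChart Y β').α W (chartSec (mulPresheaf Y) β' W n a)) := by
      refine (appLE_res f hU inf_le_right hW inf_le_left _).symm.trans ?_
      refine congrArg (f.appLE W (U ⊓ f ⁻¹ᵁ W) inf_le_right) ?_
      exact (comp_res (ofChart Y β').α hW s).symm.trans (congrArg (comp (ofChart Y β').α W) hs)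
    refine Eq.trans ?_ h1.symm
    refine (comp_res (ofChart X β).α _ _).symm.trans ?_
    have h2 : res (shf (chartPresheaf (mulPresheaf X) β)) inf_le_left
        (res (shf (chartPresheaf (mulPresheaf X) β)) hU (comp (chartFlat f β β' h w) V s)) =
        res (shf (chartPresheaf (mulPresheaf X) β)) (inf_le_right : U ⊓ f ⁻¹ᵁ W ≤ _)
          (comp (chartFlat f β β' h w) W (chartSec (mulPresheaf Y) β' W n a)) := by
      rw [← hs]
      refine (res_res _ _ _ _).trans ?_
      refine Eq.trans ?_ (congrArg (res (shf (chartPresheaf (mulPresheaf X) β)) inf_le_right)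
        (comp_res (chartFlat f β β' h w) hW s)).symm
      exact (res_res (ofChart X β).M (f.preimage_mono hW) inf_le_right
        (comp (chartFlat f β β' h w) V s)).symm
    refine (congrArg (comp (ofChart X β).α _) h2).trans ?_
    rw [chartFlat_chartSec]
    refine (comp_res (ofChart X β).α _ _).trans ?_
    have h3 := comp_chartSec (mulPresheaf_isSheaf X) β (f ⁻¹ᵁ W) (h n) (unitsApp f W a)
    have h4 := comp_chartSec (mulPresheaf_isSheaf Y) β' W n a
    refine (congrArg (res (mulPresheaf X) inf_le_right) h3).trans ?_
    refine Eq.trans ?_ (congrArg (f.appLE W (U ⊓ f ⁻¹ᵁ W) inf_le_right) h4).symm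
    have h5 : comp (Functor.whiskerRight f.c (forget₂ CommRingCat CommMonCat)) W
          (res (mulPresheaf Y) (le_top : W ≤ ⊤) (β' n) * a.val) =
        res (mulPresheaf X) (le_top : f ⁻¹ᵁ W ≤ ⊤) (β (h n)) * (unitsApp f W a).val := by
      refine (map_mul _ _ _).trans (congrArg (· * (unitsApp f W a).val) ?_)
      rw [← w]
      exact congrArg (fun k => k.hom (β' n)) (f.naturality (homOfLE (le_top : W ≤ ⊤)).op)
    exact (congrArg (res (mulPresheaf X) inf_le_right) h5).symm

theorem ofChartHom_flat {X Y : Scheme.{u}} (f : X ⟶ Y) {N N' : Type u} [CommMonoid N]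
    [CommMonoid N'] (β : N →* (mulPresheaf X).obj (op ⊤)) (β' : N' →* (mulPresheaf Y).obj (op ⊤))
    (h : N' →* N) (w : ∀ n, f.app ⊤ (β' n) = β (h n)) (V : Y.Opens) (U : X.Opens)
    (hU : U ≤ f ⁻¹ᵁ V) (n : N') (a : ((mulPresheaf Y).obj (op V))ˣ) :
    (ofChartHom f β β' h w).flat V U hU (chartSec (mulPresheaf Y) β' V n a) =
      chartSec (mulPresheaf X) β U (h n) (Units.map (f.appLE V U hU).hom.toMonoidHom a) := by
  refine (congrArg (res (shf (chartPresheaf (mulPresheaf X) β)) hU)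
    (chartFlat_chartSec f β β' h w V n a)).trans ?_
  rw [res_chartSec]
  rfl

/-- Morphisms to a log scheme with a chart are determined by the underlying morphism of schemes
and their values on the sections `(n, u)`. -/
theorem ofChart_hom_ext {X : LogScheme.{u}} {Y : Scheme.{u}} {N : Type u} [CommMonoid N]
    (β : N →* (mulPresheaf Y).obj (op ⊤)) {f g : Hom X (ofChart Y β)} (h : f.hom = g.hom)
    (h' : ∀ (V : Y.Opens) (U : X.toScheme.Opens) (hf : U ≤ f.hom ⁻¹ᵁ V)
      (hg : U ≤ g.hom ⁻¹ᵁ V) (n : N) (a : ((mulPresheaf Y).obj (op V))ˣ),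
      f.flat V U hf (chartSec (mulPresheaf Y) β V n a) =
        g.flat V U hg (chartSec (mulPresheaf Y) β V n a)) : f = g := by
  refine Hom.ext h fun V U hf hg s => sheaf_ext X.isSheaf _ _ fun x hx => ?_
  obtain ⟨W, hW, hxW, n, a, hs⟩ := exists_chartSec _ β s (f.hom.base x) (hf hx)
  refine ⟨U ⊓ f.hom ⁻¹ᵁ W, inf_le_left, ⟨hx, hxW⟩, ?_⟩
  have hg' : U ⊓ f.hom ⁻¹ᵁ W ≤ g.hom ⁻¹ᵁ W := by rw [← h]; exact inf_le_right
  refine (f.flat_res hf inf_le_right hW inf_le_left s).symm.trans ?_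
  refine Eq.trans ?_ (g.flat_res hg hg' hW inf_le_left s)
  have := h' W _ inf_le_right hg' n a
  rw [← hs] at this
  exact this

end LogScheme

theorem appLE_congr_hom {X Y : Scheme.{u}} {f g : X ⟶ Y} (h : f = g) {V : Y.Opens} {U : X.Opens}
    (hf : U ≤ f ⁻¹ᵁ V) (hg : U ≤ g ⁻¹ᵁ V) (a : Γ(Y, V)) :
    f.appLE V U hf a = g.appLE V U hg a := by
  subst h; rfl

theorem appLE_appLE {X Y Z : Scheme.{u}} (f : X ⟶ Y) (g : Y ⟶ Z) {V : Z.Opens} {U : X.Opens}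
    (h : U ≤ (f ≫ g) ⁻¹ᵁ V) (a : Γ(Z, V)) :
    f.appLE (g ⁻¹ᵁ V) U h (g.appLE V (g ⁻¹ᵁ V) le_rfl a) = (f ≫ g).appLE V U h a :=
  congrArg (fun k => k.hom a) (Scheme.Hom.appLE_comp_appLE f g V (g ⁻¹ᵁ V) U le_rfl h)

/-! ### Spectra of monoid algebras as log schemes -/

/-- The affine scheme `Spec R[N]` of a commutative monoid `N`. -/
def monSpec (R : Type u) [CommRing R] (N : CommMonCat.{u}) : Scheme.{u} :=
  Spec (CommRingCat.of (MonoidAlgebra R N))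

/-- The morphism `Spec R[N] → Spec R[N']` induced by a homomorphism `N' → N`. -/
def monSpecMap (R : Type u) [CommRing R] {N N' : CommMonCat.{u}} (h : N' ⟶ N) :
    monSpec R N ⟶ monSpec R N' :=
  Spec.map (CommRingCat.ofHom (MonoidAlgebra.mapDomainRingHom R h.hom))

theorem monSpecMap_id (R : Type u) [CommRing R] (N : CommMonCat.{u}) :
    monSpecMap R (𝟙 N) = 𝟙 _ := by
  simp only [monSpecMap, CommMonCat.hom_id, MonoidAlgebra.mapDomainRingHom_id]
  exact Spec.map_id _

theorem monSpecMap_comp (R : Type u) [CommRing R] {L N K : CommMonCat.{u}} (g : K ⟶ N)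
    (f : N ⟶ L) : monSpecMap R (g ≫ f) = monSpecMap R f ≫ monSpecMap R g := by
  simp only [monSpecMap, CommMonCat.hom_comp, MonoidAlgebra.mapDomainRingHom_comp]
  rw [CommRingCat.ofHom_comp]
  exact Spec.map_comp _ _

/-- The structure morphism `Spec R[N] → Spec R`. -/
def monSpecStr (R : Type u) [CommRing R] (N : CommMonCat.{u}) :
    monSpec R N ⟶ Spec (CommRingCat.of R) :=
  Spec.map (CommRingCat.ofHom (algebraMap R (MonoidAlgebra R N)))

theorem monSpecMap_str (R : Type u) [CommRing R] {N N' : CommMonCat.{u}} (h : N' ⟶ N) :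
    monSpecMap R h ≫ monSpecStr R N' = monSpecStr R N := by
  rw [monSpecMap, monSpecStr, monSpecStr, ← MonoidAlgebra.mapDomainRingHom_comp_algebraMap h.hom,
    CommRingCat.ofHom_comp]
  exact (Spec.map_comp _ _).symm

/-- The canonical homomorphism `N → R[N] = Γ(Spec R[N], 𝒪)`. -/
def monChart (R : Type u) [CommRing R] (N : CommMonCat.{u}) :
    N →* (mulPresheaf (monSpec R N)).obj (op ⊤) :=
  (Scheme.ΓSpecIso (CommRingCat.of (MonoidAlgebra R N))).inv.hom.toMonoidHom.comp
    (MonoidAlgebra.of R N)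

theorem monChart_map (R : Type u) [CommRing R] {N N' : CommMonCat.{u}} (h : N' ⟶ N) (n : N') :
    (monSpecMap R h).app ⊤ (monChart R N' n) = monChart R N (h.hom n) := by
  have := congrArg (fun k => k.hom (MonoidAlgebra.of R N' n)) (Scheme.ΓSpecIso_inv_naturality
    (CommRingCat.ofHom (MonoidAlgebra.mapDomainRingHom R h.hom)))
  refine Eq.trans this.symm ?_
  refine congrArg (Scheme.ΓSpecIso (CommRingCat.of (MonoidAlgebra R N))).inv.hom ?_
  exact MonoidAlgebra.mapDomain_single

namespace LogScheme

/-- The functor `N ↦ Spec R[N]`, with the log structure generated by `N → R[N]`. -/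
def monLogSpec (R : Type u) [CommRing R] : CommMonCat.{u}ᵒᵖ ⥤ LogScheme.{u} where
  obj N := ofChart (monSpec R N.unop) (monChart R N.unop)
  map h := ofChartHom (monSpecMap R h.unop) _ _ h.unop.hom (monChart_map R h.unop)
  map_id N := by
    refine ofChart_hom_ext _ (monSpecMap_id R N.unop) fun V U hf hg n a => ?_
    refine (ofChartHom_flat _ _ _ _ (monChart_map R (𝟙 N.unop)) V U hf n a).trans ?_
    refine Eq.trans ?_ (res_chartSec (mulPresheaf (monSpec R N.unop)) _ hg n a).symm
    refine congrArg (chartSec _ _ U n) (Units.ext ?_)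
    exact (appLE_congr_hom (monSpecMap_id R N.unop) hf hg a.val).trans (id_appLE_apply _ hg a.val)
  map_comp {L N K} f g := by
    refine ofChart_hom_ext _ (monSpecMap_comp R g.unop f.unop) fun V U hf hg n a => ?_
    refine (ofChartHom_flat _ _ _ _ (monChart_map R (g.unop ≫ f.unop)) V U hf n a).trans ?_
    refine Eq.trans ?_ (congrArg (Hom.flat (ofChartHom (monSpecMap R f.unop) _ _ f.unop.hom
      (monChart_map R f.unop)) (monSpecMap R g.unop ⁻¹ᵁ V) U hg)
      (ofChartHom_flat (monSpecMap R g.unop) _ _ _ (monChart_map R g.unop) V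
        (monSpecMap R g.unop ⁻¹ᵁ V) le_rfl n a)).symm
    refine Eq.trans ?_ (ofChartHom_flat _ _ _ _ (monChart_map R f.unop)
      (monSpecMap R g.unop ⁻¹ᵁ V) U hg _ _).symm
    refine congrArg (chartSec _ _ U _) (Units.ext ?_)
    exact (appLE_congr_hom (monSpecMap_comp R g.unop f.unop) hf hg a.val).trans
      (appLE_appLE (monSpecMap R f.unop) (monSpecMap R g.unop) hg a.val).symm

/-! ### Gluing log structures -/

/-- Let `F` be a diagram of log schemes and `ι_j : F_j → X` a compatible family of morphisms of
schemes. These are the sections over `V` of the glued sheaf of monoids: families of sections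
`s_j ∈ M_j(ι_j⁻¹ V)` that correspond to each other under the transition morphisms of `F`, together
with a function `a ∈ 𝒪_X(V)` whose pullback to each `F_j` is `α_j(s_j)`. When the `ι_j` are open
immersions that exhibit `X` as the gluing of the `F_j`, the function `a` is determined by the
`s_j`. -/
def glueSections {J : Type u} [Category.{u} J] (F : J ⥤ LogScheme.{u}) {X : Scheme.{u}}
    (ι : ∀ j, (F.obj j).toScheme ⟶ X)
    (hι : ∀ {i j : J} (f : i ⟶ j), Hom.hom (F.map f) ≫ ι j = ι i) (V : X.Opens) :
    Submonoid ((mulPresheaf X).obj (op V) × ∀ j, (F.obj j).M.obj (op (ι j ⁻¹ᵁ V))) where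
  carrier := {p | (∀ j, comp (F.obj j).α _ (p.2 j) = (ι j).app V p.1) ∧
    ∀ {i j : J} (f : i ⟶ j), Hom.flat (F.map f) (ι j ⁻¹ᵁ V) (ι i ⁻¹ᵁ V)
      (by rw [← hι f]; exact le_rfl) (p.2 j) = p.2 i}
  one_mem' := ⟨fun j => (map_one _).trans (map_one ((ι j).app V).hom).symm, fun f => map_one _⟩
  mul_mem' {p q} hp hq :=
    ⟨fun j => (map_mul _ _ _).trans ((congrArg₂ (· * ·) (hp.1 j) (hq.1 j)).trans
      (map_mul ((ι j).app V).hom _ _).symm),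
     fun f => (map_mul _ _ _).trans (congrArg₂ (· * ·) (hp.2 f) (hq.2 f))⟩

end LogScheme

namespace LogScheme

/-- Restriction of glued sections. -/
def glueRes {J : Type u} [Category.{u} J] (F : J ⥤ LogScheme.{u}) {X : Scheme.{u}}
    (ι : ∀ j, (F.obj j).toScheme ⟶ X)
    (hι : ∀ {i j : J} (f : i ⟶ j), Hom.hom (F.map f) ≫ ι j = ι i) {V W : X.Opens} (h : W ≤ V) :
    glueSections F ι hι V →* glueSections F ι hι W where
  toFun p := ⟨(res (mulPresheaf X) h p.1.1,
      fun j => res (F.obj j).M ((ι j).preimage_mono h) (p.1.2 j)),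
    fun j => (comp_res (F.obj j).α ((ι j).preimage_mono h) (p.1.2 j)).trans
      ((congrArg (res (mulPresheaf _) ((ι j).preimage_mono h)) (p.2.1 j)).trans
        (congrArg (fun k => k.hom p.1.1) ((ι j).naturality (homOfLE h).op)).symm),
    fun {i j} f => (Hom.flat_res (F.map f) _ _ ((ι j).preimage_mono h) ((ι i).preimage_mono h)
      (p.1.2 j)).trans (congrArg (res (F.obj i).M ((ι i).preimage_mono h)) (p.2.2 f))⟩
  map_one' := Subtype.ext (Prod.ext (map_one _) (funext fun j => map_one _))
  map_mul' p q := Subtype.ext (Prod.ext (map_mul _ _ _) (funext fun j => map_mul _ _ _))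

/-- The presheaf of glued sections, which is a sheaf by `gluePresheaf_isSheaf`. -/
def gluePresheaf {J : Type u} [Category.{u} J] (F : J ⥤ LogScheme.{u}) {X : Scheme.{u}}
    (ι : ∀ j, (F.obj j).toScheme ⟶ X)
    (hι : ∀ {i j : J} (f : i ⟶ j), Hom.hom (F.map f) ≫ ι j = ι i) :
    TopCat.Presheaf CommMonCat.{u} X where
  obj V := CommMonCat.of (glueSections F ι hι V.unop)
  map i := CommMonCat.ofHom (glueRes F ι hι i.unop.le)
  map_id V := CommMonCat.hom_ext <| MonoidHom.ext fun p => Subtype.ext <|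
    Prod.ext (res_self _ _ _) (funext fun j => res_self _ _ _)
  map_comp i k := CommMonCat.hom_ext <| MonoidHom.ext fun p => Subtype.ext <|
    Prod.ext (res_res _ _ _ _).symm (funext fun j => (res_res (F.obj j).M
      ((ι j).preimage_mono i.unop.le) ((ι j).preimage_mono k.unop.le) _).symm)

theorem gluePresheaf_isSheaf {J : Type u} [Category.{u} J] (F : J ⥤ LogScheme.{u})
    {X : Scheme.{u}} (ι : ∀ j, (F.obj j).toScheme ⟶ X)
    (hι : ∀ {i j : J} (f : i ⟶ j), Hom.hom (F.map f) ≫ ι j = ι i) :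
    (gluePresheaf F ι hι).IsSheaf := by
  rw [TopCat.Presheaf.isSheaf_iff_isSheafUniqueGluing]
  intro I U s hs
  have hs' : ∀ a b, glueRes F ι hι (inf_le_left : U a ⊓ U b ≤ U a) (s a) =
      glueRes F ι hι (inf_le_right : U a ⊓ U b ≤ U b) (s b) := hs
  -- glue the components
  have key : ∀ {Y : TopCat.{u}} (M : TopCat.Presheaf CommMonCat.{u} Y) (hM : M.IsSheaf)
      (U' : I → Opens Y) (V : Opens Y) (hU : ∀ i, U' i ≤ V) (hV : V ≤ iSup U')
      (t : ∀ i, M.obj (op (U' i)))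
      (ht : ∀ i j, res M (inf_le_left : U' i ⊓ U' j ≤ U' i) (t i) = res M inf_le_right (t j)),
      ∃ r : M.obj (op V), ∀ i, res M (hU i) r = t i := fun M hM U' V hU hV t ht =>
    (TopCat.Sheaf.existsUnique_gluing' ⟨M, hM⟩ U' V (fun i => homOfLE (hU i)) hV t ht).exists
  have hle : ∀ i, U i ≤ iSup U := le_iSup U
  have hcov : ∀ j, ι j ⁻¹ᵁ (iSup U) ≤ ⨆ i, ι j ⁻¹ᵁ (U i) := fun j x hx => by
    obtain ⟨i, hi⟩ := Opens.mem_iSup.mp (show (ι j).base x ∈ iSup U from hx)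
    exact Opens.mem_iSup.mpr ⟨i, hi⟩
  obtain ⟨a, ha⟩ := key (mulPresheaf X) (mulPresheaf_isSheaf X) U (iSup U) hle le_rfl
    (fun i => (s i).1.1) fun i k => congrArg (fun z => z.1.1) (hs' i k)
  have hr : ∀ j, ∃ r : (F.obj j).M.obj (op (ι j ⁻¹ᵁ iSup U)),
      ∀ i, res (F.obj j).M ((ι j).preimage_mono (hle i)) r = (s i).1.2 j := fun j =>
    key (F.obj j).M (F.obj j).isSheaf (fun i => ι j ⁻¹ᵁ (U i)) (ι j ⁻¹ᵁ iSup U)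
      (fun i => (ι j).preimage_mono (hle i)) (hcov j) (fun i => (s i).1.2 j)
      fun i k => congrArg (fun z => z.1.2 j) (hs' i k)
  choose r hr using hr
  refine ⟨⟨(a, r), fun j => ?_, fun {i j} f => ?_⟩, fun i => ?_, fun t ht => ?_⟩
  · refine sheaf_ext (mulPresheaf_isSheaf _) _ _ fun x hx => ?_
    obtain ⟨i, hi⟩ := Opens.mem_iSup.mp (hcov j hx)
    refine ⟨ι j ⁻¹ᵁ (U i), (ι j).preimage_mono (hle i), hi, ?_⟩
    refine (comp_res (F.obj j).α ((ι j).preimage_mono (hle i)) (r j)).symm.trans ?_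
    rw [hr]
    refine ((s i).2.1 j).trans ?_
    rw [← ha i]
    exact congrArg (fun k => k.hom a) ((ι j).naturality (homOfLE (hle i)).op)
  · refine sheaf_ext (F.obj i).isSheaf _ _ fun x hx => ?_
    obtain ⟨m, hm⟩ := Opens.mem_iSup.mp (hcov i hx)
    refine ⟨ι i ⁻¹ᵁ (U m), (ι i).preimage_mono (hle m), hm, ?_⟩
    refine (Hom.flat_res (F.map f) _ (by rw [← hι f]; exact le_rfl)
      ((ι j).preimage_mono (hle m)) ((ι i).preimage_mono (hle m)) (r j)).symm.trans ?_
    rw [hr, hr]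
    exact (s m).2.2 f
  · exact Subtype.ext (Prod.ext (ha i) (funext fun j => hr j i))
  · have ht' : ∀ i, glueRes F ι hι (hle i) t = s i := ht
    refine Subtype.ext (Prod.ext ?_ (funext fun j => ?_))
    · refine sheaf_ext (mulPresheaf_isSheaf _) _ _ fun x hx => ?_
      obtain ⟨i, hi⟩ := Opens.mem_iSup.mp hx
      refine ⟨U i, hle i, hi, ?_⟩
      exact (congrArg (fun z => z.1.1) (ht' i)).trans (ha i).symm
    · refine sheaf_ext (F.obj j).isSheaf _ _ fun x hx => ?_
      obtain ⟨i, hi⟩ := Opens.mem_iSup.mp (hcov j hx)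
      refine ⟨ι j ⁻¹ᵁ (U i), (ι j).preimage_mono (hle i), hi, ?_⟩
      exact (congrArg (fun z => z.1.2 j) (ht' i)).trans (hr j i).symm

/-- The scheme `X` with the log structure glued from the log structures of the `F_j`. -/
def glue {J : Type u} [Category.{u} J] (F : J ⥤ LogScheme.{u}) {X : Scheme.{u}}
    (ι : ∀ j, (F.obj j).toScheme ⟶ X)
    (hι : ∀ {i j : J} (f : i ⟶ j), Hom.hom (F.map f) ≫ ι j = ι i) : LogScheme.{u} where
  toScheme := X
  M := gluePresheaf F ι hι
  isSheaf := gluePresheaf_isSheaf F ι hι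
  α := { app V := CommMonCat.ofHom ((MonoidHom.fst _ _).comp (Submonoid.subtype _))
         naturality _ _ _ := rfl }
  existsUnique_of_isUnit V a ha := by
    have hu : ∀ j, IsUnit ((ι j).app V a) := fun j => ha.map ((ι j).app V).hom
    choose r hr hr' using fun j => (F.obj j).existsUnique_of_isUnit (ι j ⁻¹ᵁ V) _ (hu j)
    refine ⟨⟨(a, r), hr, fun {i j} f => hr' i _ ?_⟩, rfl, ?_⟩
    · refine (Hom.comp_flat (F.map f) _ _ _ _).trans ?_
      rw [hr, ← Scheme.Hom.appLE_eq_app]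
      refine (congrArg (fun k => k.hom a) (Scheme.Hom.appLE_comp_appLE (Hom.hom (F.map f)) (ι j)
        V (ι j ⁻¹ᵁ V) (ι i ⁻¹ᵁ V) le_rfl _)).trans ?_
      rw [← Scheme.Hom.appLE_eq_app]
      exact appLE_congr_hom (hι f) _ _ a
    · rintro ⟨⟨a', r'⟩, h1, h2⟩ (rfl : a' = a)
      exact Subtype.ext (Prod.ext rfl (funext fun j => hr' j _ (h1 j)))

/-- The canonical morphisms to the glued log scheme. -/
def glueι {J : Type u} [Category.{u} J] (F : J ⥤ LogScheme.{u}) {X : Scheme.{u}}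
    (ι : ∀ j, (F.obj j).toScheme ⟶ X)
    (hι : ∀ {i j : J} (f : i ⟶ j), Hom.hom (F.map f) ≫ ι j = ι i) (j : J) :
    F.obj j ⟶ glue F ι hι where
  hom := ι j
  flat V U h :=
    { toFun p := res (F.obj j).M h (p.1.2 j)
      map_one' := map_one _
      map_mul' p q := map_mul _ _ _ }
  flat_res {V V' U U'} h h' hV hU p :=
    (res_res (F.obj j).M ((ι j).preimage_mono hV) h' (p.1.2 j)).trans
      (res_res (F.obj j).M h hU (p.1.2 j)).symm
  comp_flat V U h p := (comp_res (F.obj j).α h (p.1.2 j)).trans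
    (congrArg (res (mulPresheaf _) h) (p.2.1 j))

end LogScheme

/-! ### Toric schemes -/

/-- The inclusion `Q^∨ → P^∨` for `P ⊆ Q`. -/
def dualMonIncl {G : Type u} [AddCommGroup G] {P Q : AddSubmonoid G} (h : P ≤ Q) :
    dualMon Q ⟶ dualMon P :=
  dualMonMap (AddMonoidHom.id G) (by rwa [AddSubmonoid.map_id])

namespace Fan

/-- The functor `P ↦ P^∨` on a fan, ordered by inclusion. -/
def dualFunctor {G : Type u} [AddCommGroup G] (Δ : Fan G) : Δ.cones ⥤ CommMonCat.{u}ᵒᵖ where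
  obj P := op (dualMon P.1)
  map f := (dualMonIncl (leOfHom f)).op
  map_id _ := rfl
  map_comp _ _ := rfl

/-- The diagram of the affine log schemes `U_P = Spec R[P^∨]`, `P ∈ Δ`, with the log structures
generated by `P^∨ → R[P^∨]`. -/
def logDiagram {G : Type u} [AddCommGroup G] (Δ : Fan G) (R : Type u) [CommRing R] :
    Δ.cones ⥤ LogScheme.{u} :=
  Δ.dualFunctor ⋙ LogScheme.monLogSpec R

/-- The diagram of the affine schemes `U_P = Spec R[P^∨]`, `P ∈ Δ`. -/
def diagram {G : Type u} [AddCommGroup G] (Δ : Fan G) (R : Type u) [CommRing R] :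
    Δ.cones ⥤ Scheme.{u} :=
  Δ.logDiagram R ⋙ LogScheme.forget

theorem isFace_of_le {G : Type u} [AddCommGroup G] (Δ : Fan G) {P Q : AddSubmonoid G}
    (hP : P ∈ Δ.cones) (hQ : Q ∈ Δ.cones) (h : P ≤ Q) : IsFace P Q := by
  have := (Δ.inter_isFace P hP Q hQ).2
  rwa [inf_eq_left.mpr h] at this

theorem inf_mem {G : Type u} [AddCommGroup G] (Δ : Fan G) {P Q : AddSubmonoid G}
    (hP : P ∈ Δ.cones) (hQ : Q ∈ Δ.cones) : P ⊓ Q ∈ Δ.cones :=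
  Δ.face_mem P hP _ (Δ.inter_isFace P hP Q hQ).1

end Fan

theorem isOpenImmersion_of_away {A B : Type u} [CommRing A] [CommRing B] (j : A →+* B) (a : A)
    (h : let := j.toAlgebra; IsLocalization.Away a B) :
    IsOpenImmersion (Spec.map (CommRingCat.ofHom j)) := by
  let := j.toAlgebra
  have : IsLocalization.Away a B := h
  exact IsOpenImmersion.of_isLocalization a

theorem range_comap_of_away {A B : Type u} [CommRing A] [CommRing B] (j : A →+* B) (a : A)
    (h : let := j.toAlgebra; IsLocalization.Away a B) :
    Set.range (PrimeSpectrum.comap j) = (PrimeSpectrum.basicOpen a : Set (PrimeSpectrum A)) := by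
  let := j.toAlgebra
  have : IsLocalization.Away a B := h
  exact PrimeSpectrum.localization_away_comap_range B a

theorem IsSupporting.isOpenImmersion (R : Type u) [CommRing R] {G : Type u}
    [AddCommGroup G] {τ : G →+ ℤ} {F P : AddSubmonoid G} (hτ : IsSupporting τ F P) (hP : P.FG)
    (hFP : F ≤ P) : IsOpenImmersion (monSpecMap R (dualMonIncl hFP)) := by
  let j : Multiplicative (dual P) →* Multiplicative (dual F) := (dualMonIncl hFP).hom
  exact isOpenImmersion_of_away (MonoidAlgebra.mapDomainRingHom R j) _
    (hτ.isLocalization R hP hFP j fun σ => rfl)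

/-- The monomial `σ ∈ P^∨` as an element of `R[P^∨]`. -/
abbrev monomial (R : Type u) [CommRing R] {G : Type u} [AddCommGroup G] {P : AddSubmonoid G}
    (σ : dual P) : MonoidAlgebra R (dualMon P) :=
  MonoidAlgebra.of R (Multiplicative (dual P)) (Multiplicative.ofAdd σ)

theorem IsSupporting.range_eq (R : Type u) [CommRing R] {G : Type u}
    [AddCommGroup G] {τ : G →+ ℤ} {F P : AddSubmonoid G} (hτ : IsSupporting τ F P) (hP : P.FG)
    (hFP : F ≤ P) :
    Set.range (PrimeSpectrum.comap (MonoidAlgebra.mapDomainRingHom R (dualMonIncl hFP).hom)) =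
      (PrimeSpectrum.basicOpen (monomial R ⟨τ, hτ.mem_dual⟩) : Set (PrimeSpectrum _)) := by
  let j : Multiplicative (dual P) →* Multiplicative (dual F) := (dualMonIncl hFP).hom
  exact range_comap_of_away (MonoidAlgebra.mapDomainRingHom R j) _
    (hτ.isLocalization R hP hFP j fun σ => rfl)

theorem IsSupporting.exists_comap (R : Type u) [CommRing R] {G : Type u}
    [AddCommGroup G] {τ σ : G →+ ℤ} {E F P : AddSubmonoid G} (hτ : IsSupporting τ E P)
    (hσ : IsSupporting σ F P) (hP : P.FG) (hE : E ≤ P) (hF : F ≤ P) (hEF : E ⊓ F ≤ P)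
    (x : PrimeSpectrum (MonoidAlgebra R (dualMon E)))
    (y : PrimeSpectrum (MonoidAlgebra R (dualMon F)))
    (hxy : PrimeSpectrum.comap (MonoidAlgebra.mapDomainRingHom R (dualMonIncl hE).hom) x =
      PrimeSpectrum.comap (MonoidAlgebra.mapDomainRingHom R (dualMonIncl hF).hom) y) :
    ∃ w, PrimeSpectrum.comap (MonoidAlgebra.mapDomainRingHom R (dualMonIncl hEF).hom) w =
      PrimeSpectrum.comap (MonoidAlgebra.mapDomainRingHom R (dualMonIncl hE).hom) x := by
  have h1 := (hτ.range_eq R hP hE).le ⟨x, rfl⟩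
  have h2 := (hσ.range_eq R hP hF).le ⟨y, hxy.symm⟩
  refine ((hτ.add hσ).range_eq R hP hEF).ge ?_
  have : monomial R ⟨τ + σ, (hτ.add hσ).mem_dual⟩ =
      monomial R ⟨τ, hτ.mem_dual⟩ * monomial R ⟨σ, hσ.mem_dual⟩ :=
    map_mul (MonoidAlgebra.of R (Multiplicative (dual P)))
      (Multiplicative.ofAdd ⟨τ, hτ.mem_dual⟩) (Multiplicative.ofAdd ⟨σ, hσ.mem_dual⟩)
  rw [this, PrimeSpectrum.basicOpen_mul]
  exact ⟨h1, h2⟩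

namespace Fan

instance isOpenImmersion_diagram_map {G : Type u} [AddCommGroup G] [Module.Free ℤ G]
    [Module.Finite ℤ G] (Δ : Fan G) (R : Type u) [CommRing R] {P Q : Δ.cones} (f : P ⟶ Q) :
    IsOpenImmersion ((Δ.diagram R).map f) := by
  obtain ⟨τ, hτ⟩ := (Δ.isFace_of_le P.2 Q.2 (leOfHom f)).exists_isSupporting
    (Δ.isConvexCone Q.1 Q.2).fg
  exact hτ.isOpenImmersion R (Δ.isConvexCone Q.1 Q.2).fg (leOfHom f)

instance isLocallyDirected_diagram {G : Type u} [AddCommGroup G] [Module.Free ℤ G]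
    [Module.Finite ℤ G] (Δ : Fan G) (R : Type u) [CommRing R] :
    (Δ.diagram R ⋙ Scheme.forget).IsLocallyDirected where
  cond {P Q K} f g x y hxy := by
    have hK := (Δ.isConvexCone K.1 K.2).fg
    obtain ⟨τ, hτ⟩ := (Δ.isFace_of_le P.2 K.2 (leOfHom f)).exists_isSupporting hK
    obtain ⟨σ, hσ⟩ := (Δ.isFace_of_le Q.2 K.2 (leOfHom g)).exists_isSupporting hK
    let L : Δ.cones := ⟨P.1 ⊓ Q.1, Δ.inf_mem P.2 Q.2⟩
    let a : L ⟶ P := homOfLE (inf_le_left : P.1 ⊓ Q.1 ≤ P.1)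
    let b : L ⟶ Q := homOfLE (inf_le_right : P.1 ⊓ Q.1 ≤ Q.1)
    obtain ⟨w, hw⟩ := hτ.exists_comap R hσ hK (leOfHom f) (leOfHom g) (leOfHom (a ≫ f)) x y hxy
    have ha : (Δ.diagram R).map (a ≫ f) = _ := (Δ.diagram R).map_comp a f
    have hb : (Δ.diagram R).map (b ≫ g) = _ := (Δ.diagram R).map_comp b g
    have hw' : (Δ.diagram R).map (a ≫ f) w = (Δ.diagram R).map f x := hw
    refine ⟨L, a, b, w, ?_, ?_⟩
    · refine ((Δ.diagram R).map f).isOpenEmbedding.injective ?_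
      refine Eq.trans ?_ hw'
      exact (congrArg (fun k => k w) ha).symm
    · refine ((Δ.diagram R).map g).isOpenEmbedding.injective ?_
      refine Eq.trans ?_ (hw'.trans hxy)
      exact (congrArg (fun k => k w) hb).symm

/-- The toric scheme of the fan `Δ` over `R`: the affine schemes `U_P`, `P ∈ Δ`, glued along the
open subschemes `U_Q ⊆ U_P`, `Q ⊆ P`. -/
def toricScheme {G : Type u} [AddCommGroup G] [Module.Free ℤ G] [Module.Finite ℤ G] (Δ : Fan G)
    (R : Type u) [CommRing R] : Scheme.{u} :=
  colimit (Δ.diagram R)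

/-- The toric scheme of `Δ` over `R` with its canonical log structure, obtained by gluing the log
structures of the `U_P`, `P ∈ Δ`. -/
def toricLog {G : Type u} [AddCommGroup G] [Module.Free ℤ G] [Module.Finite ℤ G] (Δ : Fan G)
    (R : Type u) [CommRing R] : LogScheme.{u} :=
  LogScheme.glue (X := Δ.toricScheme R) (Δ.logDiagram R) (fun P => colimit.ι (Δ.diagram R) P)
    (fun f => colimit.w (Δ.diagram R) f)

/-- The morphism of log schemes `U_P → Temb_R(Δ)`, `P ∈ Δ`. -/
def toricι {G : Type u} [AddCommGroup G] [Module.Free ℤ G] [Module.Finite ℤ G] (Δ : Fan G)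
    (R : Type u) [CommRing R] (P : Δ.cones) : (Δ.logDiagram R).obj P ⟶ Δ.toricLog R :=
  LogScheme.glueι (X := Δ.toricScheme R) (Δ.logDiagram R) (fun P => colimit.ι (Δ.diagram R) P)
    (fun f => colimit.w (Δ.diagram R) f) P

/-- The structure morphism of the toric scheme of `Δ` over `R`. -/
def toricStr {G : Type u} [AddCommGroup G] [Module.Free ℤ G] [Module.Finite ℤ G] (Δ : Fan G)
    (R : Type u) [CommRing R] : (Δ.toricLog R).toScheme ⟶ Spec (CommRingCat.of R) :=
  colimit.desc (Δ.diagram R) ⟨Spec (CommRingCat.of R),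
    { app P := monSpecStr R (dualMon P.1)
      naturality _ _ f := (monSpecMap_str R (dualMonIncl (leOfHom f))).trans
        (Category.comp_id _).symm }⟩

end Fan

/-- The morphism of log schemes `U_P → U_{P'}` given by `σ ↦ σ ∘ φ`, `P'^∨ → P^∨`, where
`φ : (G, Δ) → (G', Δ')` is a homomorphism of fans and `φ(P) ⊆ P'`. -/
def FanHom.chartMap {G G' : Type u} [AddCommGroup G] [AddCommGroup G'] {Δ : Fan G} {Δ' : Fan G'}
    (φ : FanHom Δ Δ') (R : Type u) [CommRing R] (P : Δ.cones) (P' : Δ'.cones)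
    (h : P.1.map φ.toHom ≤ P'.1) : (Δ.logDiagram R).obj P ⟶ (Δ'.logDiagram R).obj P' :=
  (LogScheme.monLogSpec R).map (dualMonMap φ.toHom h).op

end

end ToricGeometry

/-! A morphism out of `Temb_R(Δ)` is the same as a compatible family of morphisms out of the charts
`U_P`, and the family prescribed by `φ` is compatible because two cones of `Δ'` containing `φ(P)`
meet in a cone of `Δ'` that still contains `φ(P)`.

The universal property has two layers. The underlying scheme is a colimit of the `U_P`, which
settles the morphism of schemes. The log structure is not a colimit by definition: a section of the
glued sheaf over `U` is a function on `U` together with matching sections on the preimages of `U` in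
the charts. For a fixed morphism of schemes `h : X → Y`, a homomorphism from the sheaf of `Y` into
this one is therefore a matching family of homomorphisms into the sheaves of the charts; its
component in `𝒪_X` is forced, by compatibility with `α`, to be the pullback under `h` of `α`. This
gives existence (`glueDesc`, `glueι_desc`) and uniqueness (`glue_hom_ext`), and for fans
`Fan.exists_toricLog_desc` and `Fan.toricLog_hom_ext`.

It remains to study `U_P → U_{P'} → Temb_R(Δ')`. If `φ(P)` lies in both `P'` and `Q'`, it lies in
`P' ∩ Q'`, which the fan axioms place in `Δ'`. Both composites then factor through `U_{P' ∩ Q'}`, on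
which the inclusions of `U_{P'}` and `U_{Q'}` agree, so the composite depends on `P` alone
(`FanHom.chartMap_toricι`). Compatibility for `P ⊆ Q` follows, since a cone containing `φ(Q)`
contains `φ(P)` as well. The family thus glues to a unique morphism, and being over `R` can be
tested on the charts. -/

namespace ToricGeometry

noncomputable section

/-! ### Morphisms out of a glued log scheme -/

namespace LogScheme

/-- The bound on `U` is expressed through `Hom.hom f`, so an equality of morphisms cannot be
rewritten inside `Hom.flat` without changing the type of that argument. Taking both bounds
separately lets equalities of morphisms be applied to sections. -/
theorem Hom.flat_congr {X Y : LogScheme.{u}} {f g : X ⟶ Y} (h : f = g) {V : Y.toScheme.Opens}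
    {U : X.toScheme.Opens} (hf : U ≤ Hom.hom f ⁻¹ᵁ V) (hg : U ≤ Hom.hom g ⁻¹ᵁ V)
    (s : Y.M.obj (op V)) : Hom.flat f V U hf s = Hom.flat g V U hg s := by
  subst h; rfl

/-- The canonical morphisms to the glued log scheme form a cocone. -/
theorem map_glueι {J : Type u} [Category.{u} J] (F : J ⥤ LogScheme.{u}) {X : Scheme.{u}}
    (ι : ∀ j, (F.obj j).toScheme ⟶ X)
    (hι : ∀ {i j : J} (f : i ⟶ j), Hom.hom (F.map f) ≫ ι j = ι i) {i j : J} (f : i ⟶ j) :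
    F.map f ≫ glueι F ι hι j = glueι F ι hι i := by
  refine Hom.ext (hι f) fun V U hf hg s => ?_
  have hle : ι i ⁻¹ᵁ V ≤ Hom.hom (F.map f) ⁻¹ᵁ (ι j ⁻¹ᵁ V) := by rw [← hι f]; exact le_rfl
  -- The composite passes through the full preimage `ι j ⁻¹ᵁ V`, where `glueι` merely extracts the
  -- `j`-th component of `s`.
  have h1 : (Hom.flat (F.map f ≫ glueι F ι hι j) V U hf) s =
      Hom.flat (F.map f) (ι j ⁻¹ᵁ V) U (hg.trans hle) (s.1.2 j) :=
    congrArg (Hom.flat (F.map f) (ι j ⁻¹ᵁ V) U (hg.trans hle)) (res_self (F.obj j).M _ (s.1.2 j))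
  refine h1.trans ?_
  -- The matching condition on `s` lives over the full preimage `ι i ⁻¹ᵁ V`; naturality carries it
  -- down to `U`.
  have h2 := Hom.flat_res (F.map f) hle (hg.trans hle) le_rfl hg (s.1.2 j)
  rw [res_self] at h2
  exact h2.trans (congrArg (res (F.obj i).M hg) (s.2.2 f))

/-- A compatible family of morphisms of log schemes `g_j : F_j → Y` together with a morphism of
schemes `h : X → Y` extending the underlying morphisms of schemes induces a morphism from the glued
log scheme to `Y`. -/
def glueDesc {J : Type u} [Category.{u} J] (F : J ⥤ LogScheme.{u}) {X : Scheme.{u}}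
    (ι : ∀ j, (F.obj j).toScheme ⟶ X)
    (hι : ∀ {i j : J} (f : i ⟶ j), Hom.hom (F.map f) ≫ ι j = ι i) {Y : LogScheme.{u}}
    (g : ∀ j, F.obj j ⟶ Y) (hg : ∀ {i j : J} (f : i ⟶ j), F.map f ≫ g j = g i)
    (h : X ⟶ Y.toScheme) (hh : ∀ j, ι j ≫ h = Hom.hom (g j)) : glue F ι hι ⟶ Y where
  hom := h
  flat V U hU :=
    have hle : ∀ j, ι j ⁻¹ᵁ U ≤ Hom.hom (g j) ⁻¹ᵁ V := fun j => by
      rw [← hh j]; exact (ι j).preimage_mono hU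
    -- Since `α` of the glued log scheme is the projection to the function component, that component
    -- must be the pullback of `α(s)` along `h`. With this choice `comp_flat` below holds by
    -- definition.
    { toFun s := ⟨(h.appLE V U hU (comp Y.α V s), fun j => Hom.flat (g j) V (ι j ⁻¹ᵁ U) (hle j) s),
        -- The function restricts correctly to `F_j`: `α_j` of the `j`-th component is the pullback
        -- of `α(s)` under `g j`, and the scheme morphism of `g j` factors as `ι j` followed by `h`.
        fun j => by
          refine ((g j).comp_flat V _ (hle j) s).trans ?_
          refine (appLE_congr_hom (hh j).symm (hle j) ((ι j).preimage_mono hU) _).trans ?_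
          have := congrArg (fun k => k.hom (comp Y.α V s)) (Scheme.Hom.appLE_comp_appLE (ι j) h
            V U (ι j ⁻¹ᵁ U) hU le_rfl)
          exact this.symm.trans (congrArg (fun k => k.hom (h.appLE V U hU (comp Y.α V s)))
            (Scheme.Hom.appLE_eq_app (ι j) (U := U))),
        -- The components match along `f` because `F.map f ≫ g j = g i`, read on sections.
        fun {i j} f => by
          have hij : ι i ⁻¹ᵁ U ≤ Hom.hom (F.map f) ⁻¹ᵁ (ι j ⁻¹ᵁ U) := by
            rw [← hι f]; exact le_rfl
          have h1 : ι i ⁻¹ᵁ U ≤ Hom.hom (F.map f ≫ g j) ⁻¹ᵁ V := by rw [hg f]; exact hle i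
          exact (Hom.trans_flat (F.map f) (g j) h1 hij (hle j) s).symm.trans
            (Hom.flat_congr (hg f) h1 (hle i) s)⟩
      map_one' := Subtype.ext (Prod.ext ((congrArg _ (map_one (comp Y.α V))).trans
        (map_one (h.appLE V U hU).hom)) (funext fun j => map_one _))
      map_mul' s t := Subtype.ext (Prod.ext ((congrArg _ (map_mul (comp Y.α V) s t)).trans
        (map_mul (h.appLE V U hU).hom _ _)) (funext fun j => map_mul _ _ _)) }
  flat_res {V V' U U'} hU hU' hV hUU s := Subtype.ext <| Prod.ext
    ((congrArg (h.appLE V' U' hU') (comp_res Y.α hV s)).trans (appLE_res h hU hU' hV hUU _))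
    (funext fun j => (g j).flat_res _ _ hV ((ι j).preimage_mono hUU) s)
  comp_flat V U hU s := rfl

/-- The `j`-th component of the section built by `glueDesc` over `h ⁻¹ᵁ V` is the value of `g j` on
its full preimage in `F_j`. Composing with `glueι` restricts this to `U`, which by naturality is the
value of `g j` on `U`. -/
theorem glueι_desc {J : Type u} [Category.{u} J] (F : J ⥤ LogScheme.{u}) {X : Scheme.{u}}
    (ι : ∀ j, (F.obj j).toScheme ⟶ X)
    (hι : ∀ {i j : J} (f : i ⟶ j), Hom.hom (F.map f) ≫ ι j = ι i) {Y : LogScheme.{u}}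
    (g : ∀ j, F.obj j ⟶ Y) (hg : ∀ {i j : J} (f : i ⟶ j), F.map f ≫ g j = g i)
    (h : X ⟶ Y.toScheme) (hh : ∀ j, ι j ≫ h = Hom.hom (g j)) (j : J) :
    glueι F ι hι j ≫ glueDesc F ι hι g hg h hh = g j := by
  refine Hom.ext (hh j) fun V U hf hU s => ?_
  have hle : ι j ⁻¹ᵁ (h ⁻¹ᵁ V) ≤ Hom.hom (g j) ⁻¹ᵁ V := by rw [← hh j]; exact le_rfl
  refine ((g j).flat_res hle hU le_rfl hf s).symm.trans ?_
  rw [res_self]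

/-- Morphisms from a glued log scheme are determined by the underlying morphism of schemes and
their restrictions to the `F_j`. -/
theorem glue_hom_ext {J : Type u} [Category.{u} J] (F : J ⥤ LogScheme.{u}) {X : Scheme.{u}}
    (ι : ∀ j, (F.obj j).toScheme ⟶ X)
    (hι : ∀ {i j : J} (f : i ⟶ j), Hom.hom (F.map f) ≫ ι j = ι i) {Y : LogScheme.{u}}
    {f g : glue F ι hι ⟶ Y} (h : Hom.hom f = Hom.hom g)
    (h' : ∀ j, glueι F ι hι j ≫ f = glueι F ι hι j ≫ g) : f = g := by
  refine Hom.ext h fun V U hf hg s => Subtype.ext (Prod.ext ?_ (funext fun j => ?_))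
  -- The function component is `α` of the section, hence the pullback of `α(s)` under the common
  -- morphism of schemes.
  · exact (Hom.comp_flat f V U hf s).trans
      ((appLE_congr_hom h hf hg _).trans (Hom.comp_flat g V U hg s).symm)
  -- The `j`-th component is recovered by composing with `glueι` and evaluating on the whole of `ι j
  -- ⁻¹ᵁ U`, where its restriction is the identity.
  · have key : ∀ (k : glue F ι hι ⟶ Y) (hk : U ≤ Hom.hom k ⁻¹ᵁ V),
        (Hom.flat k V U hk s).1.2 j =
          Hom.flat (glueι F ι hι j ≫ k) V (ι j ⁻¹ᵁ U) ((ι j).preimage_mono hk) s := fun k hk => by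
      refine Eq.trans ?_ (Hom.trans_flat (glueι F ι hι j) k ((ι j).preimage_mono hk)
        (W := U) le_rfl hk s).symm
      exact (res_self (F.obj j).M _ _).symm
    rw [key f hf, key g hg]
    exact Hom.flat_congr (h' j) _ _ s

end LogScheme

/-! ### The universal property of the toric log scheme -/

theorem Fan.map_toricι {G : Type u} [AddCommGroup G] [Module.Free ℤ G] [Module.Finite ℤ G]
    (Δ : Fan G) (R : Type u) [CommRing R] {P Q : Δ.cones} (f : P ⟶ Q) :
    (Δ.logDiagram R).map f ≫ Δ.toricι R Q = Δ.toricι R P :=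
  LogScheme.map_glueι (X := Δ.toricScheme R) _ _ (fun f => colimit.w (Δ.diagram R) f) f

theorem Fan.toricι_str {G : Type u} [AddCommGroup G] [Module.Free ℤ G] [Module.Finite ℤ G]
    (Δ : Fan G) (R : Type u) [CommRing R] (P : Δ.cones) :
    LogScheme.Hom.hom (Δ.toricι R P) ≫ Δ.toricStr R = monSpecStr R (dualMon P.1) :=
  colimit.ι_desc _ _

/-- Morphisms of schemes from the toric scheme of `Δ` are determined on the `U_P`, `P ∈ Δ`. -/
theorem Fan.toricScheme_hom_ext {G : Type u} [AddCommGroup G] [Module.Free ℤ G]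
    [Module.Finite ℤ G] (Δ : Fan G) (R : Type u) [CommRing R] {Y : Scheme.{u}}
    {f g : (Δ.toricLog R).toScheme ⟶ Y} (h : ∀ P, LogScheme.Hom.hom (Δ.toricι R P) ≫ f =
      LogScheme.Hom.hom (Δ.toricι R P) ≫ g) : f = g :=
  colimit.hom_ext (F := Δ.diagram R) h

/-- Morphisms of log schemes from the toric scheme of `Δ` are determined on the `U_P`, `P ∈ Δ`. -/
theorem Fan.toricLog_hom_ext {G : Type u} [AddCommGroup G] [Module.Free ℤ G]
    [Module.Finite ℤ G] (Δ : Fan G) (R : Type u) [CommRing R] {Y : LogScheme.{u}}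
    {f g : Δ.toricLog R ⟶ Y} (h : ∀ P, Δ.toricι R P ≫ f = Δ.toricι R P ≫ g) : f = g :=
  LogScheme.glue_hom_ext (X := Δ.toricScheme R) _ _ (fun f => colimit.w (Δ.diagram R) f)
    (Δ.toricScheme_hom_ext R (f := LogScheme.Hom.hom f) (g := LogScheme.Hom.hom g)
      fun P => congrArg LogScheme.Hom.hom (h P)) h

/-- A compatible family of morphisms of log schemes `U_P → Y`, `P ∈ Δ`, glues to a morphism of log
schemes `Temb_R(Δ) → Y`. -/
theorem Fan.exists_toricLog_desc {G : Type u} [AddCommGroup G] [Module.Free ℤ G]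
    [Module.Finite ℤ G] (Δ : Fan G) (R : Type u) [CommRing R] {Y : LogScheme.{u}}
    (g : ∀ P, (Δ.logDiagram R).obj P ⟶ Y)
    (hg : ∀ {P Q : Δ.cones} (f : P ⟶ Q), (Δ.logDiagram R).map f ≫ g Q = g P) :
    ∃ f : Δ.toricLog R ⟶ Y, ∀ P, Δ.toricι R P ≫ f = g P :=
  -- The underlying morphism comes from the colimit of schemes; `glueDesc` then supplies the
  -- homomorphism of sheaves of monoids over it.
  let c : Cocone (Δ.diagram R) := ⟨Y.toScheme,
    { app P := LogScheme.Hom.hom (g P)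
      naturality _ _ f := (congrArg LogScheme.Hom.hom (hg f)).trans (Category.comp_id _).symm }⟩
  ⟨LogScheme.glueDesc (X := Δ.toricScheme R) _ _ (fun f => colimit.w (Δ.diagram R) f) g hg
      (colimit.desc (Δ.diagram R) c) (colimit.ι_desc c),
    LogScheme.glueι_desc (X := Δ.toricScheme R) _ _ (fun f => colimit.w (Δ.diagram R) f) g hg _ _⟩

/-! ### Chart morphisms of a homomorphism of fans -/

namespace FanHom

/-- On dual monoids both sides are `σ ↦ σ ∘ φ`, so functoriality of `monLogSpec` suffices. This
shrinks the source cone; `chartMap_map` is the counterpart that enlarges the target cone. -/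
theorem map_chartMap {G G' : Type u} [AddCommGroup G] [AddCommGroup G'] {Δ : Fan G} {Δ' : Fan G'}
    (φ : FanHom Δ Δ') (R : Type u) [CommRing R] {P Q : Δ.cones} (f : P ⟶ Q) (P' : Δ'.cones)
    (hP : P.1.map φ.toHom ≤ P'.1) (hQ : Q.1.map φ.toHom ≤ P'.1) :
    (Δ.logDiagram R).map f ≫ φ.chartMap R Q P' hQ = φ.chartMap R P P' hP :=
  ((LogScheme.monLogSpec R).map_comp (Δ.dualFunctor.map f) (dualMonMap φ.toHom hQ).op).symm

theorem chartMap_map {G G' : Type u} [AddCommGroup G] [AddCommGroup G'] {Δ : Fan G} {Δ' : Fan G'}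
    (φ : FanHom Δ Δ') (R : Type u) [CommRing R] (P : Δ.cones) {P' Q' : Δ'.cones} (f : P' ⟶ Q')
    (hP : P.1.map φ.toHom ≤ P'.1) (hQ : P.1.map φ.toHom ≤ Q'.1) :
    φ.chartMap R P P' hP ≫ (Δ'.logDiagram R).map f = φ.chartMap R P Q' hQ :=
  ((LogScheme.monLogSpec R).map_comp (dualMonMap φ.toHom hP).op (Δ'.dualFunctor.map f)).symm

/-- The composite `U_P → U_{P'} → Temb_R(Δ')` does not depend on the choice of `P'`. -/
theorem chartMap_toricι {G G' : Type u} [AddCommGroup G] [AddCommGroup G'] [Module.Free ℤ G']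
    [Module.Finite ℤ G'] {Δ : Fan G} {Δ' : Fan G'} (φ : FanHom Δ Δ') (R : Type u) [CommRing R]
    (P : Δ.cones) (P' Q' : Δ'.cones) (hP : P.1.map φ.toHom ≤ P'.1)
    (hQ : P.1.map φ.toHom ≤ Q'.1) :
    φ.chartMap R P P' hP ≫ Δ'.toricι R P' = φ.chartMap R P Q' hQ ≫ Δ'.toricι R Q' := by
  -- The intersection is a face of `P'`, hence a cone of the fan, and it contains `φ(P)`; both
  -- composites factor through its chart.
  let L : Δ'.cones := ⟨P'.1 ⊓ Q'.1, Δ'.inf_mem P'.2 Q'.2⟩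
  let a : L ⟶ P' := homOfLE (inf_le_left : P'.1 ⊓ Q'.1 ≤ P'.1)
  let b : L ⟶ Q' := homOfLE (inf_le_right : P'.1 ⊓ Q'.1 ≤ Q'.1)
  rw [← φ.chartMap_map R P a (le_inf hP hQ) hP, ← φ.chartMap_map R P b (le_inf hP hQ) hQ,
    Category.assoc, Category.assoc, Δ'.map_toricι, Δ'.map_toricι]

/-- The homomorphism `R[P'^∨] → R[P^∨]` moves only monomials, so it fixes the coefficients in `R`.
-/
theorem chartMap_str {G G' : Type u} [AddCommGroup G] [AddCommGroup G'] {Δ : Fan G} {Δ' : Fan G'}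
    (φ : FanHom Δ Δ') (R : Type u) [CommRing R] (P : Δ.cones) (P' : Δ'.cones)
    (h : P.1.map φ.toHom ≤ P'.1) :
    LogScheme.Hom.hom (φ.chartMap R P P' h) ≫ monSpecStr R (dualMon P'.1) =
      monSpecStr R (dualMon P.1) :=
  monSpecMap_str R (dualMonMap φ.toHom h)

end FanHom

end

end ToricGeometry

/-! ### Gluing the chart morphisms -/

theorem mainTheorem8 {R G G' : Type u} [CommRing R]
    [AddCommGroup G] [Module.Free ℤ G] [Module.Finite ℤ G]
    [AddCommGroup G'] [Module.Free ℤ G'] [Module.Finite ℤ G']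
    (Δ : ToricGeometry.Fan G) (Δ' : ToricGeometry.Fan G') (φ : ToricGeometry.FanHom Δ Δ') :
    ∃! f : Δ.toricLog R ⟶ Δ'.toricLog R,
      ToricGeometry.LogScheme.Hom.hom f ≫ Δ'.toricStr R = Δ.toricStr R ∧
      ∀ (P : Δ.cones) (P' : Δ'.cones) (h : P.1.map φ.toHom ≤ P'.1),
        Δ.toricι R P ≫ f = φ.chartMap R P P' h ≫ Δ'.toricι R P' := by
  have hex : ∀ P : Δ.cones, ∃ P' : Δ'.cones, P.1.map φ.toHom ≤ P'.1 := fun P =>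
    let ⟨P', hP', h⟩ := φ.exists_le P.1 P.2
    ⟨⟨P', hP'⟩, h⟩
  -- The choice of target cones need not respect inclusions; independence of the choice makes up for
  -- this.
  choose c hc using hex
  obtain ⟨f, hf⟩ := Δ.exists_toricLog_desc R (fun P => φ.chartMap R P (c P) (hc P) ≫
    Δ'.toricι R (c P)) fun {P Q} k => by
      -- The cone chosen for `Q` also serves `P`, so restricting the morphism on `U_Q` to `U_P`
      -- gives the composite through `c Q`, to be compared with the one through `c P`.
      have hPQ : P.1.map φ.toHom ≤ (c Q).1 := (AddSubmonoid.monotone_map (leOfHom k)).trans (hc Q)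
      rw [← Category.assoc, φ.map_chartMap R k (c Q) hPQ (hc Q)]
      exact φ.chartMap_toricι R P _ _ _ _
  refine ⟨f, ⟨Δ.toricScheme_hom_ext R fun P => ?_, fun P P' h => ?_⟩, fun g hg => ?_⟩
  -- On `U_P`, both sides reduce to the structure morphism of `Spec R[P^∨]`.
  · rw [← Category.assoc, ← ToricGeometry.LogScheme.comp_hom, hf,
      ToricGeometry.LogScheme.comp_hom, Category.assoc, Δ'.toricι_str, Δ.toricι_str]
    exact φ.chartMap_str R P (c P) (hc P)
  · exact (hf P).trans (φ.chartMap_toricι R P _ _ _ _)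
  -- Every `P` has some admissible target, so the condition at `c P` fixes the morphism on each
  -- chart.
  · exact Δ.toricLog_hom_ext R fun P => (hg.2 P (c P) (hc P)).trans (hf P).symm
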